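/- \textbf{Setting.} A finite Markov decision process (MDP) has agent vertices $V_A$, randomization vertices $V_R$, agent edges with real rewards $r$, and randomization edges with transition probabilities; every vertex has an outgoing edge. A \emph{sink} is an agent vertex, reachable from all vertices, whose only outgoing edge is a self-loop of reward $0$. A \emph{policy} $\pi$ selects an outgoing edge $(u,\pi(u))$ in every $u\in V_A$; it is \emph{weak unichain} if it reaches a sink with probability one from every vertex. Its values solve the Bellman equations $\mathrm{Val}_\pi(u)=r(u,\pi(u))+\mathrm{Val}_\pi(\pi(u))$ for $u\in V_A$ and $\mathrm{Val}_\pi(u)=\sum_w p(u,w)\mathrm{Val}_\pi(w)$ for $u\in V_R$, with value $0$ at a sink. An agent edge $e=(u,w)$ is an \emph{improving switch} if $z_\pi(e)=r(e)+\mathrm{Val}_\pi(w)-\mathrm{Val}_\pi(u)>0$; applying it yields the policy $\pi^{e}$, which agrees with $\pi$ except that $\pi^{e}(u)=w$. Policy iteration applies one improving switch in each step until there is none. Bland's rule chooses the improving switch with the smallest number in a fixed numbering of the agent edges, Dantzig's rule one that maximizes $z_\pi(e)$, and the Largest Increase rule one that maximizes $\sum_{v\in V_A}\mathrm{Val}_{\pi^{e}}(v)$.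 \textbf{The processes.} Let $n\ge 1$. Let $B_n$ be the directed graph with vertices $t,a_1,b_1,\dots,a_n,b_n,\ d=b_{n+1},\ s=a_{n+1}$ and, for $i=1,\dots,n$, the edges (with rewards) $t\to a_i$ (0), $a_i\to b_i$ ($2^i$), $a_i\to a_{i+1}$ (0), $a_i\to t$ ($-2^i+1.25$), $b_i\to b_{i+1}$ ($0.75$), $b_i\to a_{i+1}$ (0), and also $d\to s$ (0) and the loop $s\to s$ (0). Its edges are numbered as follows: $t\to a_i$ gets $i$; the edges $a_i\to b_i$, $a_i\to a_{i+1}$, $a_i\to t$, $b_i\to b_{i+1}$, $b_i\to a_{i+1}$ get $n+k+5(i-1)$ for $k=1,\dots,5$, in this order; $d\to s$ gets $6n+1$. Number the vertices $t,a_1,b_1,\dots,a_n,b_n,d$ by $1,2,3,\dots,2n+2$, and put $p_v=2^{-k(n+5)}$ for the vertex $v$ with number $k$. The MDP $D_n$ arises from $B_n$ by replacing every edge $v\to w$ other than $s\to s$ as follows: add new agent vertices $x_{v,w},z_{v,w}$ and a new randomization vertex $y_{v,w}$, the agent edges $v\to x_{v,w}$, $x_{v,w}\to v$, $x_{v,w}\to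 y_{v,w}$ with reward $0$, the agent edge $z_{v,w}\to w$ with the reward of $v\to w$, and the randomization edges $y_{v,w}\to z_{v,w}$ with probability $p_v$ and $y_{v,w}\to v$ with probability $1-p_v$. Bland's rule on $D_n$ uses any numbering of the agent edges in which all edges $x_{v,w}\to v$ come first, in any order, and then, in the order of the numbers of the edges $v\to w$ of $B_n$, $x_{v,w}\to y_{v,w}$ followed by $v\to x_{v,w}$ (the numbers of the edges $z_{v,w}\to w$ and $s\to s$ do not matter). The initial policy $\pi_0'$ is the following: if $v\to w$ is one of the edges $t\to a_1$, $a_i\to a_{i+1}$, $b_i\to a_{i+1}$ $(1\le i\le n)$ and $d\to s$, then $v\to x_{v,w}$ and $x_{v,w}\to y_{v,w}$ are active; for all other edges $v\to w$ with $v\neq s$, $x_{v,w}\to v$ is active. \textbf{Corollary.} The number of vertices and edges of $D_n$ is $O(n)$, $\pi_0'$ is weak unichain, and policy iteration on $D_n$ with initial policy $\pi_0'$ performs $\Omega(2^n)$ improving switches for any deterministic or randomized combination of Bland's, Dantzig's and the Largest Increase rule. That is, there is a constant $c>0$ such that, for all $n\ge 1$, every execution in which the switch of each step is chosen by one of the three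 rules (possibly a different one in each step, with ties broken arbitrarily) visits only weak unichain policies and performs at least $c\,2^n$ improving switches. In particular, if these choices are made at random in an arbitrary way, possibly depending on the past, then at least $c\,2^n$ improving switches are performed almost surely, and hence in expectation. -/

import Mathlib

open scoped ENNReal Topology

/-- A finite Markov decision process with agent vertices `A` and randomization vertices `R`.
Edges are ordered pairs of vertices; the values of `reward` off the agent edges are irrelevant. -/
structure MDP (A R : Type*) [Fintype A] [Fintype R] where
  agentEdge : Set (A × (A ⊕ R))
  randEdge : Set (R × (A ⊕ R))
  reward : A × (A ⊕ R) → ℝ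
  prob : R × (A ⊕ R) → ℝ
  exists_agentEdge : ∀ u : A, ∃ w, (u, w) ∈ agentEdge
  exists_randEdge : ∀ u : R, ∃ w, (u, w) ∈ randEdge
  prob_nonneg : ∀ e, 0 ≤ prob e
  prob_eq_zero : ∀ e, e ∉ randEdge → prob e = 0
  prob_sum : ∀ u : R, ∑ w, prob (u, w) = 1

namespace MDP

variable {A R : Type*} [Fintype A] [Fintype R] [DecidableEq A]

/-- The size of a process: its number of vertices plus its number of edges. -/
noncomputable def size (G : MDP A R) : ℕ :=
  Fintype.card A + Fintype.card R + G.agentEdge.ncard + G.randEdge.ncard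

/-- `w` can be reached from `v` in one step along an edge of the process. -/
def Adj (G : MDP A R) (v w : A ⊕ R) : Prop :=
  match v with
  | .inl u => (u, w) ∈ G.agentEdge
  | .inr u => (u, w) ∈ G.randEdge

/-- A sink: the only outgoing edge is a self-loop, its reward is zero, and it can be reached from
every vertex. -/
def IsSink (G : MDP A R) (s : A) : Prop :=
  (∀ w, (s, w) ∈ G.agentEdge ↔ w = .inl s) ∧ G.reward (s, .inl s) = 0 ∧
    ∀ v, Relation.ReflTransGen G.Adj v (.inl s)

/-- A policy selects an outgoing edge in every agent vertex. -/
def IsPolicy (G : MDP A R) (π : A → A ⊕ R) : Prop :=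
  ∀ u, (u, π u) ∈ G.agentEdge

open Classical in
/-- The probability that the process, run with policy `π` from the given vertex, visits `s` within
the given number of steps. -/
noncomputable def hitProb (G : MDP A R) (π : A → A ⊕ R) (s : A) : ℕ → A ⊕ R → ℝ
  | 0, v => if v = .inl s then 1 else 0
  | k + 1, v =>
    if v = .inl s then 1
    else match v with
      | .inl u => G.hitProb π s k (π u)
      | .inr u => ∑ w, G.prob (u, w) * G.hitProb π s k w

/-- A policy is weak unichain if the process has a sink that the policy reaches with probability
one from every vertex. -/
def IsWeakUnichain (G : MDP A R) (π : A → A ⊕ R) : Prop :=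
  G.IsPolicy π ∧ ∃ s, G.IsSink s ∧
    ∀ v, Filter.Tendsto (fun k => G.hitProb π s k v) Filter.atTop (𝓝 1)

/-- The Bellman equations of `π`, with value zero at a sink. -/
def IsValue (G : MDP A R) (π : A → A ⊕ R) (f : A ⊕ R → ℝ) : Prop :=
  (∀ u : A, f (.inl u) = G.reward (u, π u) + f (π u)) ∧
  (∀ u : R, f (.inr u) = ∑ w, G.prob (u, w) * f w) ∧
  ∀ s, G.IsSink s → f (.inl s) = 0

open Classical in
/-- The value function of `π`: the solution of its Bellman equations. For weak unichain policies
it exists and is unique. -/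
noncomputable def value (G : MDP A R) (π : A → A ⊕ R) : A ⊕ R → ℝ :=
  if h : ∃ f, G.IsValue π f then h.choose else 0

/-- The reduced costs of an agent edge. -/
noncomputable def reducedCost (G : MDP A R) (π : A → A ⊕ R) (e : A × (A ⊕ R)) : ℝ :=
  G.reward e + G.value π e.2 - G.value π (.inl e.1)

/-- The agent edge `e` is an improving switch for `π`. -/
def IsImproving (G : MDP A R) (π : A → A ⊕ R) (e : A × (A ⊕ R)) : Prop :=
  e ∈ G.agentEdge ∧ 0 < G.reducedCost π e

/-- The policy that results from applying the switch `e` to `π`. -/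
def applySwitch (π : A → A ⊕ R) (e : A × (A ⊕ R)) : A → A ⊕ R :=
  Function.update π e.1 e.2

/-- The three pivot rules. -/
inductive PivotRule
  | bland
  | dantzig
  | largestIncrease

/-- `G.Chooses N r π e`: for the policy `π`, the rule `r` can choose the improving switch `e`
(where ties in the latter two rules are broken arbitrarily). The edge numbering `N` is the one used
by Bland's rule. -/
def Chooses (G : MDP A R) (N : A × (A ⊕ R) → ℕ) :
    PivotRule → (A → A ⊕ R) → A × (A ⊕ R) → Prop
  | .bland, π, e => G.IsImproving π e ∧ ∀ e', G.IsImproving π e' → N e ≤ N e'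
  | .dantzig, π, e => G.IsImproving π e ∧
      ∀ e', G.IsImproving π e' → G.reducedCost π e' ≤ G.reducedCost π e
  | .largestIncrease, π, e => G.IsImproving π e ∧
      ∀ e', G.IsImproving π e' →
        ∑ v : A, G.value (applySwitch π e') (.inl v) ≤ ∑ v : A, G.value (applySwitch π e) (.inl v)

/-- `X 0, X 1, …` are the policies visited by policy iteration with initial policy `π₀`, where in
every step the switch is chosen by one of the three rules and the rule may be a different one in
each step. After termination, the sequence is constant. -/
def IsCombinedRun (G : MDP A R) (N : A × (A ⊕ R) → ℕ) (π₀ : A → A ⊕ R)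
    (X : ℕ → A → A ⊕ R) : Prop :=
  X 0 = π₀ ∧ ∀ k,
    (∃ (r : PivotRule) (e : A × (A ⊕ R)), G.Chooses N r (X k) e ∧
      X (k + 1) = applySwitch (X k) e) ∨
    ((∀ e, ¬ G.IsImproving (X k) e) ∧ X (k + 1) = X k)

/-- The number of improving switches that are performed before the sequence of policies `X` reaches
a policy without improving switches (`⊤` if it never does). -/
noncomputable def numSwitches (G : MDP A R) (X : ℕ → A → A ⊕ R) : ℕ∞ :=
  ⨅ (k : ℕ) (_ : ∀ e, ¬ G.IsImproving (X k) e), (k : ℕ∞)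

end MDP

/-! ### The process `B n`

The index `i : Fin n` stands for level `i + 1`. -/

/-- The vertices of `B n`: transportation vertex `t`, two vertices per level, dummy `d`, sink `s`. -/
inductive BVertex (n : ℕ)
  | t
  | a (i : Fin n)
  | b (i : Fin n)
  | d
  | s
  deriving DecidableEq, Fintype

/-- The edges of `B n` except for the loop at the sink. -/
inductive BEdge (n : ℕ)
  | travel (i : Fin n)
  | enter (i : Fin n)
  | skip (i : Fin n)
  | board (i : Fin n)
  | stay (i : Fin n)
  | leave (i : Fin n)
  | dummy
  deriving DecidableEq, Fintype

namespace BVertex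

/-- The `a`-vertex of the next level, which is the sink after the last level. -/
def nextA {n : ℕ} (i : Fin n) : BVertex n :=
  if h : i.val + 1 < n then .a ⟨i.val + 1, h⟩ else .s

/-- The `b`-vertex of the next level, which is the dummy vertex after the last level. -/
def nextB {n : ℕ} (i : Fin n) : BVertex n :=
  if h : i.val + 1 < n then .b ⟨i.val + 1, h⟩ else .d

/-- The vertex numbering `t, a₁, b₁, a₂, b₂, …, aₙ, bₙ, d, s`, starting at one. -/
def number {n : ℕ} : BVertex n → ℕ
  | .t => 1
  | .a i => 2 * (i.val + 1)
  | .b i => 2 * (i.val + 1) + 1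
  | .d => 2 * n + 2
  | .s => 2 * n + 3

/-- The probability `2 ^ (-(number v) * (n + 5))` attached to the vertex `v`. -/
noncomputable def p {n : ℕ} (v : BVertex n) : ℝ := (1 / 2 : ℝ) ^ (v.number * (n + 5))

theorem p_pos {n : ℕ} (v : BVertex n) : 0 < v.p := by unfold p; positivity

theorem p_le_one {n : ℕ} (v : BVertex n) : v.p ≤ 1 :=
  pow_le_one₀ (by norm_num) (by norm_num)

end BVertex

namespace BEdge

/-- The start vertex of an edge. -/
def src {n : ℕ} : BEdge n → BVertex n
  | .travel _ => .t
  | .enter i => .a i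
  | .skip i => .a i
  | .board i => .a i
  | .stay i => .b i
  | .leave i => .b i
  | .dummy => .d

/-- The end vertex of an edge. -/
def tgt {n : ℕ} : BEdge n → BVertex n
  | .travel i => .a i
  | .enter i => .b i
  | .skip i => BVertex.nextA i
  | .board _ => .t
  | .stay i => BVertex.nextB i
  | .leave i => BVertex.nextA i
  | .dummy => .s

/-- The reward of an edge. -/
noncomputable def reward {n : ℕ} : BEdge n → ℝ
  | .travel _ => 0
  | .enter i => 2 ^ (i.val + 1)
  | .skip _ => 0
  | .board i => -2 ^ (i.val + 1) + 1.25
  | .stay _ => 0.75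
  | .leave _ => 0
  | .dummy => 0

/-- The Bland numbering of the edges of `B n`. -/
def number {n : ℕ} : BEdge n → ℕ
  | .travel i => i.val + 1
  | .enter i => n + 1 + 5 * i.val
  | .skip i => n + 2 + 5 * i.val
  | .board i => n + 3 + 5 * i.val
  | .stay i => n + 4 + 5 * i.val
  | .leave i => n + 5 + 5 * i.val
  | .dummy => 6 * n + 1

/-- The edges of `B n` that are active in the canonical policy for `0`: travel to the first level,
skip every level, leave every level (and go from the dummy vertex to the sink). -/
def ActiveInZero {n : ℕ} : BEdge n → Prop
  | .travel i => i.val = 0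
  | .enter _ => False
  | .skip _ => True
  | .board _ => False
  | .stay _ => False
  | .leave _ => True
  | .dummy => True

end BEdge

/-! ### The process `D n` -/

/-- The agent vertices of `D n`: those of `B n`, and vertices `x e` and `z e` for every edge `e` of
`B n` other than the loop at the sink. The randomization vertex that belongs to the edge `e` is
called `y e` in the comments; it is represented by `e` itself. -/
inductive DAgent (n : ℕ)
  | base (v : BVertex n)
  | x (e : BEdge n)
  | z (e : BEdge n)
  deriving DecidableEq, Fintype

/-- The type of all vertices of `D n`. -/
abbrev DVertex (n : ℕ) : Type := DAgent n ⊕ BEdge n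

/-- An edge of `B n` from `v` to `w` is replaced by the agent edges `v → x`, `x → v`, `x → y`,
`z → w`; the loop at the sink remains. -/
inductive DAgentEdge (n : ℕ) : DAgent n × DVertex n → Prop
  | vx (e : BEdge n) : DAgentEdge n (.base e.src, .inl (.x e))
  | xv (e : BEdge n) : DAgentEdge n (.x e, .inl (.base e.src))
  | xy (e : BEdge n) : DAgentEdge n (.x e, .inr e)
  | zw (e : BEdge n) : DAgentEdge n (.z e, .inl (.base e.tgt))
  | loop : DAgentEdge n (.base .s, .inl (.base .s))

/-- The randomization edges `y → v` and `y → z`. -/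
inductive DRandEdge (n : ℕ) : BEdge n × DVertex n → Prop
  | yv (e : BEdge n) : DRandEdge n (e, .inl (.base e.src))
  | yz (e : BEdge n) : DRandEdge n (e, .inl (.z e))

/-- The reward of the edge of `B n` is collected on `z → w`; all other rewards are zero. -/
noncomputable def dReward (n : ℕ) : DAgent n × DVertex n → ℝ
  | (.z e, _) => e.reward
  | (.base _, _) => 0
  | (.x _, _) => 0

/-- From `y`, the process moves to `v` with probability `1 - p v` and to `z` with
probability `p v`. -/
noncomputable def dProb (n : ℕ) (q : BEdge n × DVertex n) : ℝ :=
  (if q.2 = .inl (.base q.1.src) then 1 - q.1.src.p else 0) +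
    (if q.2 = .inl (.z q.1) then q.1.src.p else 0)

theorem exists_dAgentEdge (n : ℕ) [NeZero n] (u : DAgent n) : ∃ w, DAgentEdge n (u, w) := by
  rcases u with v | e | e
  · rcases v with _ | i | i | _ | _
    · exact ⟨_, .vx (.travel 0)⟩
    · exact ⟨_, .vx (.skip i)⟩
    · exact ⟨_, .vx (.leave i)⟩
    · exact ⟨_, .vx .dummy⟩
    · exact ⟨_, .loop⟩
  · exact ⟨_, .xv e⟩
  · exact ⟨_, .zw e⟩

/-- The Markov decision process `D n`, for `n ≥ 1`. -/
noncomputable def dMDP (n : ℕ) [NeZero n] : MDP (DAgent n) (BEdge n) where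
  agentEdge := {e | DAgentEdge n e}
  randEdge := {e | DRandEdge n e}
  reward := dReward n
  prob := dProb n
  exists_agentEdge := exists_dAgentEdge n
  exists_randEdge := fun e => ⟨_, .yv e⟩
  prob_nonneg := by
    rintro ⟨e, w⟩
    have h0 := e.src.p_pos
    have h1 := e.src.p_le_one
    unfold dProb
    dsimp only
    split_ifs <;> linarith
  prob_eq_zero := by
    rintro ⟨e, w⟩ h
    have h1 : w ≠ .inl (.base e.src) := by rintro rfl; exact h (.yv e)
    have h2 : w ≠ .inl (.z e) := by rintro rfl; exact h (.yz e)
    simp [dProb, h1, h2]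
  prob_sum := by
    intro e
    unfold dProb
    dsimp only
    rw [Finset.sum_add_distrib, Finset.sum_ite_eq' Finset.univ, Finset.sum_ite_eq' Finset.univ]
    simp

open Classical in
/-- The twin policy, for `D n`, of the canonical policy for `0`: if the edge `e` from `v` to `w` is
active in the latter, then `v → x e` and `x e → y e` are active, and otherwise `x e → v` is. -/
noncomputable def initialPolicy (n : ℕ) [NeZero n] : DAgent n → DVertex n
  | .base .t => .inl (.x (.travel 0))
  | .base (.a i) => .inl (.x (.skip i))
  | .base (.b i) => .inl (.x (.leave i))
  | .base .d => .inl (.x .dummy)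
  | .base .s => .inl (.base .s)
  | .x e => if e.ActiveInZero then .inr e else .inl (.base e.src)
  | .z e => .inl (.base e.tgt)

/-- The Bland numberings of the agent edges of `D n`: all edges `x e → v` come first, in arbitrary
order, and then, for the edges `e` of `B n` in the order of their Bland numbers, `x e → y e`
immediately followed by `v → x e`. The numbers of the edges `z e → w` and of the loop, which are the
unique outgoing edges of their start vertices, are arbitrary. -/
structure IsBlandNumbering (n : ℕ) (N : DAgent n × DVertex n → ℕ) : Prop where
  injOn : Set.InjOn N {e | DAgentEdge n e}
  xv_first : ∀ e f : BEdge n, N (.x e, .inl (.base e.src)) < N (.x f, .inr f)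
  xy_lt_vx : ∀ e : BEdge n, N (.x e, .inr e) < N (.base e.src, .inl (.x e))
  vx_lt_xy : ∀ e f : BEdge n, e.number < f.number →
    N (.base e.src, .inl (.x e)) < N (.x f, .inr f)

/-!
A policy of `D n` that is visited consists of a policy `σ` of `B n`, which determines the active
edges `v → x e`, and of a set `S` of *prepared* edges `e`, for which `x e → y e` is active; all edges
that `σ` uses are prepared. Such a policy has the same values in the vertices of `B n` as `σ`. So
a switch to the edge `e` of `B n` needs two switches in `D n`: one in `x e`, which prepares `e`,
and another one in `v`, which activates `e`. The reduced costs of these switches are those of `e`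
in `B n`, multiplied by `p v`. Besides, `x e → v` is an improving switch if `e` is prepared and has
negative reduced costs in `B n`; this switch resets `e`.

The reduced costs in `B n` are multiples of `1 / 4` and less than `2 ^ (n + 3)` in absolute value,
and `p v` decreases by the factor `2 ^ (n + 5)` from each vertex to the next one. Hence the
position of `v` decides the comparison of reduced costs in `D n`, and Dantzig's rule prefers the
first vertices, just like Bland's rule. The same holds for the Largest Increase rule as far as
switches in the vertices `x e` are concerned; it prefers activations to them, as these change the
sum of the values by an amount without the factor `p v`. Now suppose that the first vertex of `B n`
with an improving edge has an edge `e` with both the largest reduced costs and the smallest number,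
and that no prepared edge is improving. Then each of the rules resets some prepared edges, prepares
`e`, possibly resets further edges, and activates `e` (`TwinProcess.Preferred.minSwitches`).

So it suffices to find an exponentially long run of policies of `B n` in which the next switch
always has this property, `BinaryCounter.Ready`, no matter which of the edges have been reset
(`BinaryCounter.Leads`). It is the run of a binary counter. As soon as level `k` is entered, `t`
travels to `a k`, and this makes it attractive for the lower levels to go back to `t`: they are
reset by boarding (`BinaryCounter.reset_succ`). When they are entered again, one after another
(`BinaryCounter.count_succ`), each of them in turn causes a reset of the levels below it
(`BinaryCounter.increment`). This doubles the number of switches with each level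
(`BinaryCounter.exponential`). As the switches of an iteration depend only on the levels that are
involved, everything about the other vertices is collected in a `BinaryCounter.Frame`: their
prepared edges are not improving and their values do not exceed that of `t` as long as the latter
stays in the range that occurs.
-/

namespace BinaryCounter

/-! ### Policies of `B n` and their values -/

/-- The move that a policy makes in a vertex `a i`. -/
inductive AMove
  | enter
  | skip
  | board

/-- A policy of `B n`. Levels are indexed by all natural numbers, starting at zero; for a given `n`
only the levels below `n` matter. In `b i` the policy uses `stay` if `stays i` is true and `leave`
otherwise. -/
structure Config where
  travel : ℕ
  a : ℕ → AMove
  stays : ℕ → Bool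

/-- The edges of `B n` other than `dummy`, with levels indexed by all natural numbers. -/
inductive Edge
  | travel (i : ℕ)
  | enter (i : ℕ)
  | skip (i : ℕ)
  | board (i : ℕ)
  | stay (i : ℕ)
  | leave (i : ℕ)

namespace Edge

/-- The level of an edge. -/
def level : Edge → ℕ
  | travel i | enter i | skip i | board i | stay i | leave i => i

/-- The position of the start vertex of an edge in the order `t, a 0, b 0, a 1, b 1, …`. -/
def rank : Edge → ℕ
  | travel _ => 0
  | enter i | skip i | board i => 2 * i + 1
  | stay i | leave i => 2 * i + 2

/-- The order in which Bland's rule considers the edges with a common start vertex. -/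
def prio : Edge → ℕ
  | travel i => i
  | enter _ => 0
  | skip _ => 1
  | board _ => 2
  | stay _ => 0
  | leave _ => 1

end Edge

namespace Config

/-- The values of the two vertices of the level `n - m`, as functions of the value `T` of `t`. -/
noncomputable def levelValues (n : ℕ) (c : Config) (T : ℝ) : ℕ → ℝ × ℝ
  | 0 => (0, 0)
  | m + 1 =>
    let q := levelValues n c T m
    let b := if c.stays (n - 1 - m) then 3 / 4 + q.2 else q.1
    (match c.a (n - 1 - m) with
      | .enter => 2 ^ (n - 1 - m + 1) + b
      | .skip => q.1
      | .board => T - 2 ^ (n - 1 - m + 1) + 5 / 4, b)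

/-- The value of `a j`, given the value `T` of `t`. -/
noncomputable def A (c : Config) (n : ℕ) (T : ℝ) (j : ℕ) : ℝ := (levelValues n c T (n - j)).1

/-- The value of `b j`, given the value `T` of `t`. -/
noncomputable def B (c : Config) (n : ℕ) (T : ℝ) (j : ℕ) : ℝ := (levelValues n c T (n - j)).2

variable {c c' : Config} {n j k p : ℕ} {T : ℝ}

theorem A_last : c.A n T n = 0 := by simp [A, levelValues]

theorem B_last : c.B n T n = 0 := by simp [B, levelValues]

theorem levelValues_eq (hj : j < n) : levelValues n c T (n - j) =
    (match c.a j with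
      | .enter => 2 ^ (j + 1) + (if c.stays j then 3 / 4 + c.B n T (j + 1) else c.A n T (j + 1))
      | .skip => c.A n T (j + 1)
      | .board => T - 2 ^ (j + 1) + 5 / 4,
     if c.stays j then 3 / 4 + c.B n T (j + 1) else c.A n T (j + 1)) := by
  obtain ⟨m, rfl⟩ : ∃ m, n = j + m + 1 := ⟨n - j - 1, by omega⟩
  have h1 : j + m + 1 - j = m + 1 := by omega
  have h2 : j + m + 1 - 1 - m = j := by omega
  have h3 : j + m + 1 - (j + 1) = m := by omega
  simp only [A, B, h1, h3, levelValues, h2]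

theorem B_of_stay (hj : j < n) (h : c.stays j = true) :
    c.B n T j = 3 / 4 + c.B n T (j + 1) := by
  rw [B, levelValues_eq hj]; simp [h]

theorem B_of_leave (hj : j < n) (h : c.stays j = false) : c.B n T j = c.A n T (j + 1) := by
  rw [B, levelValues_eq hj]; simp [h]

theorem A_of_enter (hj : j < n) (h : c.a j = .enter) :
    c.A n T j = 2 ^ (j + 1) + c.B n T j := by
  rw [A, B, levelValues_eq hj]; simp [h]

theorem A_of_skip (hj : j < n) (h : c.a j = .skip) : c.A n T j = c.A n T (j + 1) := by
  rw [A, levelValues_eq hj]; simp [h]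

theorem A_of_board (hj : j < n) (h : c.a j = .board) :
    c.A n T j = T - 2 ^ (j + 1) + 5 / 4 := by
  rw [A, levelValues_eq hj]; simp [h]

/-- The reduced costs of an edge, given the value `T` of `t`. -/
noncomputable def z (c : Config) (n : ℕ) (T : ℝ) : Edge → ℝ
  | .travel i => c.A n T i - T
  | .enter i => 2 ^ (i + 1) + c.B n T i - c.A n T i
  | .skip i => c.A n T (i + 1) - c.A n T i
  | .board i => T - 2 ^ (i + 1) + 5 / 4 - c.A n T i
  | .stay i => 3 / 4 + c.B n T (i + 1) - c.B n T i
  | .leave i => c.A n T (i + 1) - c.B n T i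

/-- The policy uses the given edge. -/
def Active (c : Config) : Edge → Prop
  | .travel i => c.travel = i
  | .enter i => c.a i = .enter
  | .skip i => c.a i = .skip
  | .board i => c.a i = .board
  | .stay i => c.stays i = true
  | .leave i => c.stays i = false

theorem z_of_active {e : Edge} (he : e.level < n) (h1 : 1 ≤ e.rank) (h : c.Active e) :
    c.z n T e = 0 := by
  cases e <;> simp only [Edge.level, Edge.rank, Active] at he h1 h <;> simp only [z]
  case travel => omega
  case enter i => linarith [A_of_enter (T := T) he h]
  case skip i => linarith [A_of_skip (T := T) he h]
  case board i => linarith [A_of_board (T := T) he h]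
  case stay i => linarith [B_of_stay (T := T) he h]
  case leave i => linarith [B_of_leave (T := T) he h]

/-- The policy that results from switching to an edge. -/
def switch (c : Config) : Edge → Config
  | .travel i => { c with travel := i }
  | .enter i => { c with a := Function.update c.a i .enter }
  | .skip i => { c with a := Function.update c.a i .skip }
  | .board i => { c with a := Function.update c.a i .board }
  | .stay i => { c with stays := Function.update c.stays i true }
  | .leave i => { c with stays := Function.update c.stays i false }

/-- Two policies agree in all vertices of rank at least `p`, except for `t`. -/
def AgreeFrom (p : ℕ) (c c' : Config) : Prop :=
  (∀ j, p ≤ 2 * j + 1 → c'.a j = c.a j) ∧ ∀ j, p ≤ 2 * j + 2 → c'.stays j = c.stays j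

theorem AgreeFrom.values (h : AgreeFrom p c c') : ∀ m j, j + m = n →
    (p ≤ 2 * j + 1 → c'.A n T j = c.A n T j) ∧ (p ≤ 2 * j + 2 → c'.B n T j = c.B n T j) := by
  intro m
  induction m with
  | zero =>
    intro j hj
    obtain rfl : j = n := by omega
    simp [A_last, B_last]
  | succ m ih =>
    intro j hj
    have hjn : j < n := by omega
    have hB : p ≤ 2 * j + 2 → c'.B n T j = c.B n T j := by
      intro hp
      have h1 := (ih (j + 1) (by omega)).1 (by omega)
      have h2 := (ih (j + 1) (by omega)).2 (by omega)
      have hs := h.2 j hp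
      cases hc : c.stays j with
      | false => rw [B_of_leave hjn hc, B_of_leave hjn (hs.trans hc), h1]
      | true => rw [B_of_stay hjn hc, B_of_stay hjn (hs.trans hc), h2]
    refine ⟨fun hp => ?_, hB⟩
    have ha := h.1 j hp
    cases hc : c.a j with
    | enter => rw [A_of_enter hjn hc, A_of_enter hjn (ha.trans hc), hB (by omega)]
    | skip =>
      rw [A_of_skip hjn hc, A_of_skip hjn (ha.trans hc), (ih (j + 1) (by omega)).1 (by omega)]
    | board => rw [A_of_board hjn hc, A_of_board hjn (ha.trans hc)]

theorem AgreeFrom.A_eq (h : AgreeFrom p c c') (hj : j ≤ n) (hp : p ≤ 2 * j + 1) :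
    c'.A n T j = c.A n T j := (h.values (n - j) j (by omega)).1 hp

theorem AgreeFrom.B_eq (h : AgreeFrom p c c') (hj : j ≤ n) (hp : p ≤ 2 * j + 2) :
    c'.B n T j = c.B n T j := (h.values (n - j) j (by omega)).2 hp

theorem AgreeFrom.z_eq (h : AgreeFrom p c c') {e : Edge} (he : e.level < n) (h1 : 1 ≤ p)
    (hp : p ≤ e.rank) : c'.z n T e = c.z n T e := by
  cases e <;> simp only [Edge.rank, Edge.level] at hp he <;> simp only [z]
  case travel => omega
  case enter i => rw [h.A_eq he.le hp, h.B_eq he.le (by omega)]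
  case skip i => rw [h.A_eq he.le hp, h.A_eq he (by omega)]
  case board i => rw [h.A_eq he.le hp]
  case stay i => rw [h.B_eq he.le hp, h.B_eq he (by omega)]
  case leave i => rw [h.B_eq he.le hp, h.A_eq he (by omega)]

end Config

/-! ### Runs in which every switch is forced -/

variable {n p k m j : ℕ} {c c' c'' : Config} {S S' S'' : Set Edge} {T T₀ T₁ W D : ℝ}
  {e : Edge}

/-- The outcome `(c', S')` of a part of the run that only involves vertices of rank less than `p`:
the policy is unchanged in the other vertices, and no edges that start there are added to the set
of prepared edges. -/
structure Ext (p : ℕ) (c : Config) (S : Set Edge) (c' : Config) (S' : Set Edge) : Prop where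
  agree : Config.AgreeFrom p c c'
  sub : ∀ e ∈ S', p ≤ e.rank → e ∈ S

theorem Ext.refl : Ext p c S c S := ⟨⟨fun _ _ => rfl, fun _ _ => rfl⟩, fun _ h _ => h⟩

theorem Ext.trans (h : Ext p c S c' S') (h' : Ext p c' S' c'' S'') : Ext p c S c'' S'' :=
  ⟨⟨fun j hj => (h'.agree.1 j hj).trans (h.agree.1 j hj),
    fun j hj => (h'.agree.2 j hj).trans (h.agree.2 j hj)⟩,
    fun e he hp => h.sub e (h'.sub e he hp) hp⟩

theorem Ext.mono {q : ℕ} (h : Ext p c S c' S') (hq : p ≤ q) : Ext q c S c' S' :=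
  ⟨⟨fun j hj => h.agree.1 j (by omega), fun j hj => h.agree.2 j (by omega)⟩,
    fun e he hp => h.sub e he (by omega)⟩

/-- The switch `e` is forced under each of the three rules: it starts in the first vertex with an
improving switch, where it has the largest reduced costs and the smallest number. Moreover, no
prepared edge is improving. The number `T` is the value of `t`. -/
structure Ready (n : ℕ) (c : Config) (T : ℝ) (S : Set Edge) (e : Edge) : Prop where
  travel_lt : c.travel < n
  value_t : T = c.A n T c.travel
  valid : e.level < n
  pos : 0 < c.z n T e
  lower : ∀ e' : Edge, e'.level < n → e'.rank < e.rank → c.z n T e' ≤ 0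
  same : ∀ e' : Edge, e'.level < n → e'.rank = e.rank → e' ≠ e →
    c.z n T e' < c.z n T e ∧ (0 < c.z n T e' → e.prio < e'.prio)
  stale : ∀ e' ∈ S, e'.level < n → c.z n T e' ≤ 0

/-- What is known about the set `S'` of prepared edges after the switch `e`: no other edges have
been prepared, and those with negative reduced costs that start in an earlier vertex have been
reset. Nothing is known about which of the remaining prepared edges have been reset, so the run has
to be forced for each of these sets. -/
def After (n : ℕ) (c : Config) (T : ℝ) (S : Set Edge) (e : Edge) (S' : Set Edge) : Prop :=
  ∀ e' ∈ S', e' = e ∨ (e' ∈ S ∧ (e'.level < n → e'.rank < e.rank → c.z n T e' = 0))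

/-- From the policy `c` with the set `S` of prepared edges, at least `N` switches are made before a
state with property `P` is reached. -/
inductive Leads (n : ℕ) : ℕ → Config → Set Edge → (Config → Set Edge → Prop) → Prop
  | done {c S P} : P c S → Leads n 0 c S P
  | step {N c S P T e} : Ready n c T S e →
      (∀ S', After n c T S e S' → Leads n N (c.switch e) S' P) → Leads n (N + 1) c S P
  | weaken {M N c S P} : M ≤ N → Leads n N c S P → Leads n M c S P

theorem Leads.trans {N M : ℕ} {P Q : Config → Set Edge → Prop} (h : Leads n N c S P)
    (h' : ∀ c' S', P c' S' → Leads n M c' S' Q) : Leads n (N + M) c S Q := by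
  induction h with
  | done hP => rw [Nat.zero_add]; exact h' _ _ hP
  | step hr _ ih =>
    rw [Nat.add_right_comm]
    exact .step hr fun S' hS' => ih S' hS' h'
  | weaken hle _ ih => exact .weaken (by omega) (ih h')

theorem Leads.imp {N : ℕ} {P Q : Config → Set Edge → Prop} (h : Leads n N c S P)
    (hPQ : ∀ c' S', P c' S' → Q c' S') : Leads n N c S Q :=
  Leads.trans h fun c' S' h => .done (hPQ c' S' h)

/-- The conditions on the vertices of rank at least `p` under which the value of `t` can grow from
`T₀` to `T₁` due to switches in vertices of smaller rank. -/
structure Frame (n p : ℕ) (c : Config) (S : Set Edge) (T₀ T₁ : ℝ) : Prop where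
  le : ∀ T j, T₀ ≤ T → T ≤ T₁ → j ≤ n → p ≤ 2 * j + 1 → c.A n T j ≤ T
  stale : ∀ e ∈ S, e.level < n → p ≤ e.rank → ∀ T, T₀ ≤ T → T ≤ T₁ → c.z n T e ≤ 0

theorem Frame.ext {U₀ U₁ : ℝ} {q : ℕ} (h : Frame n p c S T₀ T₁) (h' : Ext p c S c' S')
    (hp : 1 ≤ p) (hq : p ≤ q) (h₀ : T₀ ≤ U₀) (h₁ : U₁ ≤ T₁) : Frame n q c' S' U₀ U₁ where
  le T j a b hj hpj := by
    rw [h'.agree.A_eq hj (by omega)]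
    exact h.le T j (h₀.trans a) (b.trans h₁) hj (by omega)
  stale e he hl hr T a b := by
    rw [h'.agree.z_eq hl hp (by omega)]
    exact h.stale e (h'.sub e he (by omega)) hl (by omega) T (h₀.trans a) (b.trans h₁)

theorem Ext.switch (he : e.rank < p) (hS : After n c T S e S') : Ext p c S (c.switch e) S' := by
  refine ⟨?_, fun e' he' hp => ?_⟩
  · cases e <;> simp only [Edge.rank] at he <;> refine ⟨fun j hj => ?_, fun j hj => ?_⟩ <;>
      simp only [Config.switch] <;> rw [Function.update_of_ne] <;> omega
  · rcases hS e' he' with rfl | h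
    · omega
    · exact h.1

/-- A criterion for `Ready` in which the edges of large rank are dealt with by a frame. -/
theorem Ready.of_frame (hF : Frame n p c S T₀ T₁) (h₀ : T₀ ≤ T) (h₁ : T ≤ T₁)
    (travel_lt : c.travel < n) (value_t : T = c.A n T c.travel)
    (valid : e.level < n) (pos : 0 < c.z n T e)
    (lower : ∀ e' : Edge, e'.level < n → e'.rank < e.rank → c.z n T e' ≤ 0)
    (same : ∀ e' : Edge, e'.level < n → e'.rank = e.rank → e' ≠ e →
      c.z n T e' < c.z n T e ∧ (0 < c.z n T e' → e.prio < e'.prio))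
    (stale : ∀ e' ∈ S, e'.level < n → e.rank ≤ e'.rank → e'.rank < p → c.z n T e' ≤ 0) :
    Ready n c T S e where
  travel_lt := travel_lt
  value_t := value_t
  valid := valid
  pos := pos
  lower := lower
  same := same
  stale e' he' hl := by
    rcases lt_or_ge e'.rank e.rank with h | h
    · exact lower e' hl h
    · rcases lt_or_ge e'.rank p with hp | hp
      · exact stale e' he' hl h hp
      · exact hF.stale e' he' hl hp T h₀ h₁

/-- All levels below `k` are entered, and those except for the last are left. -/
def Climb (k : ℕ) (c : Config) : Prop :=
  (∀ j < k, c.a j = .enter) ∧ ∀ j, j + 1 < k → c.stays j = false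

theorem Climb.A_eq {m : ℕ} (h : Climb (m + 1) c) (hm : m < n) : ∀ i j, j + i = m →
    c.A n T j = 2 ^ (m + 2) - 2 ^ (j + 1) + c.B n T m := by
  intro i
  induction i with
  | zero =>
    intro j hj
    obtain rfl : j = m := by omega
    rw [Config.A_of_enter hm (h.1 _ (by omega))]
    ring
  | succ i ih =>
    intro j hj
    rw [Config.A_of_enter (by omega) (h.1 j (by omega)),
      Config.B_of_leave (by omega) (h.2 j (by omega)), ih (j + 1) (by omega)]
    ring

theorem two_le_two_pow (i : ℕ) : (2 : ℝ) ≤ 2 ^ (i + 1) := by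
  have := one_le_pow₀ (n := i) (one_le_two (α := ℝ))
  rw [pow_succ]; linarith

theorem two_pow_le_two_pow {i j : ℕ} (h : i ≤ j) : (2 : ℝ) ^ i ≤ 2 ^ j :=
  pow_le_pow_right₀ one_le_two h

/-- In a climb that starts from `t`, no edge below the last `b`-vertex is improving, and only
the active ones are not strictly worse. -/
theorem Climb.neg_or_active {m : ℕ} (h : Climb (m + 1) c) (hm : m < n)
    (hT : T = 2 ^ (m + 2) - 2 + c.B n T m) (hA : c.A n T (m + 1) < 2 ^ (m + 1) + c.B n T m)
    (he : e.level < n) (h1 : 1 ≤ e.rank) (h2 : e.rank ≤ 2 * m + 1) :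
    c.z n T e < 0 ∨ c.Active e := by
  have hval : ∀ j ≤ m, c.A n T j = 2 ^ (m + 2) - 2 ^ (j + 1) + c.B n T m :=
    fun j hj => h.A_eq hm (m - j) j (by omega)
  cases e <;> simp only [Edge.rank, Edge.level] at h1 h2 he <;> simp only [Config.z, Config.Active]
  case travel => omega
  case enter i => exact .inr (h.1 i (by omega))
  case skip i =>
    left
    rw [hval i (by omega)]
    have := two_le_two_pow i
    rcases (show i < m ∨ i = m by omega) with hi | rfl
    · rw [hval (i + 1) (by omega), pow_succ 2 (i + 1)]; linarith
    · rw [pow_succ 2 (i + 1)]; linarith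
  case board i => left; rw [hval i (by omega)]; linarith
  case stay i =>
    left
    have := two_le_two_pow (i + 1)
    rw [Config.B_of_leave he (h.2 i (by omega)),
      Config.A_of_enter (by omega) (h.1 (i + 1) (by omega))]
    linarith
  case leave i => exact .inr (h.2 i (by omega))

/-- A reset of the levels below `k` makes at least `N` switches. It starts when these levels are
entered, `b (k - 1)` is on `stay`, `a k` has been entered and `t` travels to it; it ends when these
levels are entered again and all of their `b`-vertices are on `leave`. Here, `D` is the value of
`b k`, and the value of `t` grows from `2 ^ (k + 1) + D` to at most `2 ^ (k + 2) - 2 + D`. -/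
def ResetSpec (n k N : ℕ) : Prop :=
  ∀ (c : Config) (S : Set Edge) (D : ℝ), k < n → c.a k = .enter → Climb k c →
    (∀ m, m + 1 = k → c.stays m = true) → c.travel = k →
    (∀ T, 2 ^ (k + 1) + D ≤ T → T ≤ 2 ^ (k + 2) - 2 + D → c.B n T k = D) →
    Frame n (2 * k + 1) c S (2 ^ (k + 1) + D) (2 ^ (k + 2) - 2 + D) →
    (∀ e ∈ S, 1 ≤ e.rank → e.rank < 2 * k + 1 → c.Active e) →
    Leads n N c S fun c' S' => Ext (2 * k + 1) c S c' S' ∧ c'.travel = 0 ∧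
      (∀ j < k, c'.a j = .enter) ∧ ∀ j < k, c'.stays j = false

/-- The state in which all levels up to `k` are entered, the levels below `k` are left, and `t`
travels to the first level. -/
def Climbed (k : ℕ) (c : Config) (S : Set Edge) (c' : Config) (S' : Set Edge) : Prop :=
  Ext (2 * k + 2) c S c' S' ∧ c'.travel = 0 ∧ Climb (k + 1) c'

/-- At least `N` switches are made from a policy in which the levels below `k` are entered and `a k`
is entered next, until all levels up to `k` are entered. Here, `D` is the value of `b k`, and `T` is
the value of `t` in the beginning. -/
def IncrementSpec (n k N : ℕ) : Prop :=
  ∀ (c : Config) (S : Set Edge) (D T : ℝ), k < n → c.travel < n → T = c.A n T c.travel →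
    T ≤ 2 ^ (k + 2) - 2 + D →
    (∀ T', T ≤ T' → T' ≤ 2 ^ (k + 2) - 2 + D → c.B n T' k = D) →
    Climb k c → (∀ m, m + 1 = k → c.stays m = true ∧ c.travel = 0) →
    (k = 0 → 1 ≤ c.travel ∧ T ≤ D) →
    c.A n T k ≤ D → c.A n T k ≤ T → (Edge.travel k ∈ S → c.A n T k < T) → c.a k ≠ .enter →
    (∀ e ∈ S, e.rank = 2 * k + 1 → c.Active e) →
    (c.a k = .skip → ∀ T', T ≤ T' → T' ≤ 2 ^ (k + 2) - 2 + D → c.A n T' (k + 1) ≤ D) →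
    Frame n (2 * k + 2) c S T (2 ^ (k + 2) - 2 + D) →
    Leads n N c S (Climbed k c S)

/-! ### Increments: entering a level -/

theorem Edge.eq_of_rank_zero (h : e.rank = 0) : ∃ i, e = .travel i := by
  cases e <;> simp only [Edge.rank] at h
  case travel i => exact ⟨i, rfl⟩
  all_goals omega

theorem Edge.level_lt (h1 : 1 ≤ e.rank) (h2 : e.rank < 2 * k + 1) : e.level < k := by
  cases e <;> simp only [Edge.rank, Edge.level] at h1 h2 ⊢ <;> omega

theorem Edge.eq_of_rank_odd (h : e.rank = 2 * k + 1) :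
    e = .enter k ∨ e = .skip k ∨ e = .board k := by
  cases e <;> simp only [Edge.rank] at h
  case travel i => omega
  case stay i => omega
  case leave i => omega
  all_goals
    rename_i i
    obtain rfl : i = k := by omega
    simp

theorem Edge.eq_of_rank_even (h : e.rank = 2 * k + 2) : e = .stay k ∨ e = .leave k := by
  cases e <;> simp only [Edge.rank] at h
  case stay i => obtain rfl : i = k := by omega
                 simp
  case leave i => obtain rfl : i = k := by omega
                  simp
  all_goals omega

/-- The values in a climb whose last `b`-vertex is on `stay`. -/
theorem Climb.A_eq_of_stay (h : Climb k c) (hs : ∀ m, m + 1 = k → c.stays m = true) (hk : k < n)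
    (hB : c.B n T k = D) {j : ℕ} (hj : j < k) :
    c.A n T j = 2 ^ (k + 1) - 2 ^ (j + 1) + 3 / 4 + D := by
  obtain ⟨m, rfl⟩ : ∃ m, k = m + 1 := ⟨k - 1, by omega⟩
  rw [h.A_eq (by omega) (m - j) j (by omega), Config.B_of_stay (by omega) (hs m rfl), hB]
  ring

/-- After `a k` has been entered, it is the best choice for `t`. Once `t` has switched to it, the
levels below `k` are reset. -/
theorem increment {N : ℕ} (h : ResetSpec n k N) : IncrementSpec n k (N + 2) := by
  intro c S D T hk htr hT hT1 hB hC hs h0 hAD hAT htk hne hclean hskip hF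
  have hpow := two_le_two_pow k
  have hpow2 : (2 : ℝ) ^ (k + 2) = 2 * 2 ^ (k + 1) := by ring
  have hBk : c.B n T k = D := hB T le_rfl hT1
  have hAj : ∀ j < k, c.A n T j = 2 ^ (k + 1) - 2 ^ (j + 1) + 3 / 4 + D :=
    fun j hj => hC.A_eq_of_stay (fun m hm => (hs m hm).1) hk hBk hj
  have hTk : 0 < k → T = 2 ^ (k + 1) - 2 + 3 / 4 + D := by
    intro h1
    have h2 := hAj 0 h1
    have h3 : T = c.A n T 0 := by rw [← (hs (k - 1) (by omega)).2]; exact hT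
    linarith
  have hTW : T < 2 ^ (k + 1) + D := by
    rcases k.eq_zero_or_pos with h1 | h1
    · linarith [(h0 h1).2]
    · linarith [hTk h1]
  have hneg : ∀ e : Edge, e.level < n → 1 ≤ e.rank → e.rank < 2 * k + 1 →
      c.z n T e < 0 ∨ c.Active e := by
    intro e he h1 h2
    obtain ⟨m, rfl⟩ : ∃ m, k = m + 1 := ⟨k - 1, by omega⟩
    have hBm : c.B n T m = 3 / 4 + D := by
      rw [Config.B_of_stay (by omega) (hs m rfl).1, hBk]
    rcases (show e.rank ≤ 2 * m + 1 ∨ e.rank = 2 * m + 2 by omega) with h3 | h3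
    · refine hC.neg_or_active (by omega) ?_ ?_ he h1 h3
      · linarith [hTk (by omega)]
      · have := two_le_two_pow m
        linarith
    · rcases Edge.eq_of_rank_even h3 with rfl | rfl
      · exact .inr (hs m rfl).1
      · left; simp only [Config.z]; linarith
  have hle : ∀ i < n, c.A n T i ≤ T := by
    intro i hi
    rcases lt_trichotomy i k with h1 | rfl | h1
    · have h2 := hTk (by omega)
      have h3 := two_le_two_pow i
      linarith [hAj i h1]
    · exact hAT
    · exact hF.le T i le_rfl hT1 hi.le (by omega)
  have hA1 : c.A n T (k + 1) ≤ T := hF.le T (k + 1) le_rfl hT1 (by omega) (by omega)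
  -- `a k` is entered.
  refine .step (T := T) (e := .enter k) (Ready.of_frame hF le_rfl hT1 htr hT hk ?_ ?_ ?_ ?_) ?_
  · simp only [Config.z]; linarith
  · intro e he hr
    have hr : e.rank < 2 * k + 1 := hr
    rcases Nat.eq_zero_or_pos e.rank with h1 | h1
    · obtain ⟨i, rfl⟩ := Edge.eq_of_rank_zero h1
      simp only [Config.z]; linarith [hle i he]
    · rcases hneg e he h1 hr with h2 | h2
      · exact h2.le
      · exact (Config.z_of_active he h1 h2).le
  · intro e he hr hne'
    rcases Edge.eq_of_rank_odd hr with rfl | rfl | rfl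
    · exact absurd rfl hne'
    · exact ⟨by simp only [Config.z]; linarith, fun _ => by simp [Edge.prio]⟩
    · exact ⟨by simp only [Config.z]; linarith, fun _ => by simp [Edge.prio]⟩
  · intro e he hl hr hr'
    have hr : 2 * k + 1 ≤ e.rank := hr
    exact (Config.z_of_active hl (by omega) (hclean e he (by omega))).le
  intro S1 hS1
  have hE1 : Ext (2 * k + 2) c S (c.switch (.enter k)) S1 := Ext.switch (by simp [Edge.rank]) hS1
  set c1 := c.switch (.enter k) with hc1
  have ha1 : ∀ j, j ≠ k → c1.a j = c.a j := fun j hj => by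
    simp [hc1, Config.switch, Function.update_of_ne hj]
  have hak1 : c1.a k = .enter := by simp [hc1, Config.switch]
  have hst1 : c1.stays = c.stays := rfl
  have htr1 : c1.travel = c.travel := rfl
  have hBk1 : ∀ T', T ≤ T' → T' ≤ 2 ^ (k + 2) - 2 + D → c1.B n T' k = D := fun T' u v => by
    rw [hE1.agree.B_eq hk.le (by omega), hB T' u v]
  have hAk1 : ∀ T', T ≤ T' → T' ≤ 2 ^ (k + 2) - 2 + D → c1.A n T' k = 2 ^ (k + 1) + D :=
    fun T' u v => by rw [Config.A_of_enter hk hak1, hBk1 T' u v]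
  have hC1 : Climb k c1 := ⟨fun j hj => (ha1 j (by omega)).trans (hC.1 j hj), hC.2⟩
  have hs1 : ∀ m, m + 1 = k → c1.stays m = true := fun m hm => (hs m hm).1
  have hAj1 : ∀ j < k, c1.A n T j = 2 ^ (k + 1) - 2 ^ (j + 1) + 3 / 4 + D :=
    fun j hj => hC1.A_eq_of_stay hs1 hk (hBk1 T le_rfl hT1) hj
  have hT' : T = c1.A n T c1.travel := by
    rcases k.eq_zero_or_pos with h1 | h1
    · have := (h0 h1).1
      rw [htr1, hE1.agree.A_eq htr.le (by omega)]
      exact hT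
    · rw [htr1, (hs (k - 1) (by omega)).2, hAj1 0 h1, hTk h1]
      ring
  have hle1 : ∀ i < n, i ≠ k → c1.A n T i ≤ T := by
    intro i hi hik
    rcases lt_or_gt_of_ne hik with h1 | h1
    · rw [hAj1 i h1, ← hAj i h1]; exact hle i hi
    · rw [hE1.agree.A_eq hi.le (by omega)]; exact hle i hi
  have hlow1 : ∀ e ∈ S1, e.level < n → 1 ≤ e.rank → e.rank < 2 * k + 1 → c1.Active e := by
    intro e he hl h1 h2
    rcases hS1 e he with rfl | ⟨-, h3⟩
    · simp [Edge.rank] at h2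
    · have h4 : c.Active e := by
        rcases hneg e hl h1 h2 with h5 | h5
        · exact absurd (h3 hl h2) h5.ne
        · exact h5
      cases e <;> simp only [Edge.rank] at h1 h2 <;> simp only [Config.Active] at h4 ⊢
      case travel => omega
      case stay => exact h4
      case leave => exact h4
      all_goals exact (ha1 _ (by omega)).trans h4
  have hk1 : ∀ e ∈ S1, e.rank = 2 * k + 1 → ∀ T', T ≤ T' → T' ≤ 2 ^ (k + 2) - 2 + D →
      c1.z n T' e ≤ 0 := by
    intro e he hr T' u v
    rcases hS1 e he with rfl | ⟨h3, -⟩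
    · exact (Config.z_of_active (e := .enter k) hk (by simp [Edge.rank]) hak1).le
    have h4 := hclean e h3 hr
    rcases Edge.eq_of_rank_odd hr with rfl | rfl | rfl
    · exact absurd h4 hne
    · simp only [Config.z]
      rw [hAk1 T' u v, hE1.agree.A_eq (by omega) (by omega)]
      linarith [hskip h4 T' u v]
    · simp only [Config.z]
      rw [hAk1 T' u v]
      linarith
  -- `t` travels to `a k`.
  have hF1 := hF.ext hE1 (by omega) le_rfl le_rfl le_rfl
  refine .step (T := T) (e := .travel k) (Ready.of_frame hF1 le_rfl hT1 htr hT' hk ?_ ?_ ?_ ?_) ?_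
  · simp only [Config.z]; rw [hAk1 T le_rfl hT1]; linarith
  · intro e he hr
    simp [Edge.rank] at hr
  · intro e he hr hne'
    obtain ⟨i, rfl⟩ := Edge.eq_of_rank_zero hr
    have h1 := hle1 i he (fun h => hne' (by rw [h]))
    simp only [Config.z]
    rw [hAk1 T le_rfl hT1]
    exact ⟨by linarith, fun h2 => by linarith⟩
  · intro e he hl _ hr'
    rcases Nat.eq_zero_or_pos e.rank with h1 | h1
    · obtain ⟨i, rfl⟩ := Edge.eq_of_rank_zero h1
      rcases eq_or_ne i k with rfl | hik
      · rcases hS1 _ he with h2 | ⟨h2, h3⟩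
        · cases h2
        · have h4 := h3 hl (by simp [Edge.rank])
          have h5 := htk h2
          simp only [Config.z] at h4
          linarith
      · simp only [Config.z]; linarith [hle1 i hl hik]
    · rcases (show e.rank < 2 * k + 1 ∨ e.rank = 2 * k + 1 by omega) with h2 | h2
      · exact (Config.z_of_active hl h1 (hlow1 e he hl h1 h2)).le
      · exact hk1 e he h2 T le_rfl hT1
  intro S2 hS2
  have hE2 : Ext 1 c1 S1 (c1.switch (.travel k)) S2 := Ext.switch (by simp [Edge.rank]) hS2
  set c2 := c1.switch (.travel k) with hc2
  have hsub2 : ∀ e ∈ S2, 1 ≤ e.rank → e ∈ S1 := fun e he hr => hE2.sub e he hr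
  have hE02 : Ext (2 * k + 2) c S c2 S2 := hE1.trans (hE2.mono (by omega))
  have hW : T ≤ 2 ^ (k + 1) + D := hTW.le
  refine .weaken (Nat.le_add_right N 0) (Leads.trans (h c2 S2 D hk hak1 hC1 hs1 rfl ?_ ?_ ?_) ?_)
  · intro T' u v
    rw [hE02.agree.B_eq hk.le (by omega), hB T' (hW.trans u) v]
  · refine ⟨fun T' j u v hj hp => ?_, fun e he hl hr T' u v => ?_⟩
    · rcases (show j = k ∨ k < j by omega) with rfl | h1
      · rw [hE2.agree.A_eq hj (by omega), hAk1 T' (hW.trans u) v]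
        exact u
      · rw [hE02.agree.A_eq hj (by omega)]
        exact hF.le T' j (hW.trans u) v hj (by omega)
    · rw [hE2.agree.z_eq hl le_rfl (by omega)]
      rcases (show e.rank = 2 * k + 1 ∨ 2 * k + 2 ≤ e.rank by omega) with h1 | h1
      · exact hk1 e (hsub2 e he (by omega)) h1 T' (hW.trans u) v
      · exact hF1.stale e (hsub2 e he (by omega)) hl h1 T' (hW.trans u) v
  · intro e he h1 h2
    have h3 := hlow1 e (hsub2 e he h1) ((Edge.level_lt h1 h2).trans hk) h1 h2
    cases e with
    | travel i => simp [Edge.rank] at h1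
    | _ => exact h3
  · rintro c' S' ⟨hE', ht', ha', hs'⟩
    refine .done ⟨hE02.trans (hE'.mono (by omega)), ht', fun j hj => ?_,
      fun j hj => hs' j (by omega)⟩
    rcases (show j < k ∨ j = k by omega) with h1 | rfl
    · exact ha' j h1
    · rw [hE'.agree.1 j le_rfl]; exact hak1

/-! ### Counting with the levels below a given one -/

/-- At least `N` switches are made from a policy in which the levels below `k` are entered and left,
and `a k` and `b k` both move on to `a (k + 1)`, until all levels up to `k` are entered. Here, `W`
is the value of `a (k + 1)`. -/
def StayIncrementSpec (n k N : ℕ) : Prop :=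
  ∀ (c : Config) (S : Set Edge) (W T : ℝ), k < n → c.travel < n → T = c.A n T c.travel →
    T ≤ 2 ^ (k + 2) - 2 + W → c.a k = .skip → c.stays k = false →
    (∀ T', T ≤ T' → T' ≤ 2 ^ (k + 2) - 2 + W → c.A n T' (k + 1) = W) →
    (∀ j < k, c.a j = .enter) → (∀ j < k, c.stays j = false) → (0 < k → c.travel = 0) →
    (k = 0 → 1 ≤ c.travel ∧ T ≤ W ∧ Edge.travel 0 ∉ S) →
    (∀ e ∈ S, e.rank = 2 * k + 1 → c.Active e) →
    (∀ m, m + 1 = k → Edge.stay m ∉ S) →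
    Frame n (2 * k + 2) c S T (2 ^ (k + 2) - 2 + W) →
    Leads n N c S (Climbed k c S)

/-- For `k > 0`, `b (k - 1)` switches to `stay` before `a k` is entered. The two values of `b k` and
`a (k + 1)` agree, so that `stay` has an advantage of `3 / 4` for `b (k - 1)`. -/
theorem stayIncrement {N : ℕ} (h : IncrementSpec n k N) : StayIncrementSpec n k N := by
  intro c S W T hk htr hT hT1 hak hsk hA hC hs ht0 h0 hclean hstay hF
  rcases k.eq_zero_or_pos with rfl | hk0
  · obtain ⟨h1, h2, h3⟩ := h0 rfl
    have h4 : c.A n T 1 = W := hA T le_rfl hT1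
    have h5 : c.A n T 0 = W := by rw [Config.A_of_skip hk hak]; exact h4
    have h6 : W ≤ T := h4 ▸ hF.le T 1 le_rfl hT1 (by omega) (by omega)
    refine h c S W T hk htr hT hT1 (fun T' u v => ?_) ⟨hC, fun j hj => by omega⟩
      (fun m hm => by omega) (fun _ => ⟨h1, h2⟩) h5.le (by linarith) (fun h => absurd h h3)
      (by rw [hak]; simp) hclean (fun _ T' u v => (hA T' u v).le) hF
    rw [Config.B_of_leave hk hsk]
    exact hA T' u v
  obtain ⟨m, rfl⟩ : ∃ m, k = m + 1 := ⟨k - 1, by omega⟩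
  have hpow := two_le_two_pow m
  have hpow2 : (2 : ℝ) ^ (m + 2) = 2 * 2 ^ (m + 1) := by ring
  have hpow3 : (2 : ℝ) ^ (m + 1 + 1) = 2 * 2 ^ (m + 1) := by ring
  have hpow4 : (2 : ℝ) ^ (m + 1 + 2) = 4 * 2 ^ (m + 1) := by ring
  have hCl : Climb (m + 1) c := ⟨hC, fun j hj => hs j (by omega)⟩
  have hAk : ∀ T', c.A n T' (m + 1) = c.A n T' (m + 1 + 1) := fun T' => Config.A_of_skip hk hak
  have hBm : c.B n T m = c.A n T (m + 1 + 1) := by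
    rw [Config.B_of_leave (by omega) (hs m (by omega)), hAk]
  have hAj : ∀ j ≤ m, c.A n T j = 2 ^ (m + 2) - 2 ^ (j + 1) + c.A n T (m + 1 + 1) :=
    fun j hj => by rw [← hBm]; exact hCl.A_eq (by omega) (m - j) j (by omega)
  have hAW : c.A n T (m + 1 + 1) = W := hA T le_rfl hT1
  have hTW : T = 2 ^ (m + 2) - 2 + W := by
    have h2 := hAj 0 (by omega)
    have h3 : T = c.A n T 0 := by rw [← ht0 hk0]; exact hT
    norm_num at h2
    linarith
  have hBW : c.B n T (m + 1) = W := by rw [Config.B_of_leave hk hsk, hAW]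
  -- `b m` changes from `leave` to `stay`.
  refine .weaken N.le_succ (.step (T := T) (e := .stay m)
    (Ready.of_frame hF le_rfl hT1 htr hT (show m < n by omega) ?_ ?_ ?_ ?_) ?_)
  · simp only [Config.z]; linarith
  · intro e he hr
    have hr : e.rank < 2 * m + 2 := hr
    rcases Nat.eq_zero_or_pos e.rank with h1 | h1
    · obtain ⟨i, rfl⟩ := Edge.eq_of_rank_zero h1
      have h3 := two_le_two_pow i
      have he : i < n := he
      simp only [Config.z]
      rcases (show i ≤ m ∨ i = m + 1 ∨ m + 1 < i by omega) with h2 | rfl | h2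
      · linarith [hAj i h2]
      · rw [hAk]; linarith
      · linarith [hF.le T i le_rfl hT1 he.le (by omega)]
    · rcases hCl.neg_or_active (T := T) (by omega) (by linarith) (by rw [hAk]; linarith) he h1
        (by omega) with h2 | h2
      · exact h2.le
      · exact (Config.z_of_active he h1 h2).le
  · intro e he hr hne
    rcases Edge.eq_of_rank_even hr with rfl | rfl
    · exact absurd rfl hne
    · exact ⟨by simp only [Config.z]; linarith [hAk T], fun _ => by simp [Edge.prio]⟩
  · intro e he hl hr hr'
    have hr : 2 * m + 2 ≤ e.rank := hr
    rcases (show e.rank = 2 * m + 2 ∨ e.rank = 2 * (m + 1) + 1 by omega) with h1 | h1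
    · rcases Edge.eq_of_rank_even h1 with rfl | rfl
      · exact absurd he (hstay m rfl)
      · exact (Config.z_of_active hl (by omega) (hs m (by omega))).le
    · exact (Config.z_of_active hl (by omega) (hclean e he h1)).le
  intro S1 hS1
  have hE1 : Ext (2 * (m + 1) + 1) c S (c.switch (.stay m)) S1 :=
    Ext.switch (show 2 * m + 2 < _ by omega) hS1
  set c1 := c.switch (.stay m) with hc1
  have hs1 : ∀ j, j ≠ m → c1.stays j = c.stays j := fun j hj => by
    simp [hc1, Config.switch, Function.update_of_ne hj]
  have hsm1 : c1.stays m = true := by simp [hc1, Config.switch]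
  have htr1 : c1.travel = 0 := ht0 hk0
  have hCl1 : Climb (m + 1) c1 := ⟨hC, fun j hj => (hs1 j (by omega)).trans (hs j (by omega))⟩
  have hsm1' : ∀ m', m' + 1 = m + 1 → c1.stays m' = true := fun m' h => by
    obtain rfl : m' = m := by omega
    exact hsm1
  have hB1 : ∀ T', T ≤ T' → T' ≤ 2 ^ (m + 1 + 2) - 2 + W → c1.B n T' (m + 1) = W :=
    fun T' u v => by rw [hE1.agree.B_eq hk.le (by omega), Config.B_of_leave hk hsk, hA T' u v]
  have hA1 : ∀ T', T ≤ T' → T' ≤ 2 ^ (m + 1 + 2) - 2 + W → c1.A n T' (m + 1 + 1) = W :=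
    fun T' u v => by rw [hE1.agree.A_eq hk (by omega), hA T' u v]
  have hle : T ≤ T + 3 / 4 := by linarith
  have hle1 : T + 3 / 4 ≤ 2 ^ (m + 1 + 2) - 2 + W := by linarith
  have hAk1 : c1.A n (T + 3 / 4) (m + 1) = W := by
    rw [Config.A_of_skip (c := c1) hk hak, hA1 _ hle hle1]
  have hT1' : T + 3 / 4 = c1.A n (T + 3 / 4) c1.travel := by
    rw [htr1, hCl1.A_eq_of_stay hsm1' hk (hB1 _ hle hle1) (by omega)]
    norm_num
    linarith
  refine (h c1 S1 W (T + 3 / 4) hk (htr1 ▸ by omega) hT1' hle1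
    (fun T' u v => hB1 T' (hle.trans u) v) hCl1 (fun m' h => ⟨hsm1' m' h, htr1⟩)
    (fun h => by omega) hAk1.le (by linarith) (fun _ => by linarith)
    (by rw [show c1.a (m + 1) = .skip from hak]; simp) ?_
    (fun _ T' u v => (hA1 T' (hle.trans u) v).le)
    (hF.ext (hE1.mono (by omega)) (by omega) le_rfl hle le_rfl)).imp ?_
  · intro e he hr
    have h1 := hclean e (hE1.sub e he (by omega)) hr
    rcases Edge.eq_of_rank_odd hr with rfl | rfl | rfl <;> exact h1
  · rintro c' S' ⟨h1, h2, h3⟩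
    exact ⟨(hE1.mono (by omega)).trans h1, h2, h3⟩

/-- At least `N` switches are made from a policy in which the levels up to `m` are boarded and the
`b`-vertices below level `m` are on `stay`, until all levels up to `m` are entered. Here, `D` is the
value of `b m`. -/
def CountSpec (n m N : ℕ) : Prop :=
  ∀ (c : Config) (S : Set Edge) (D T : ℝ), m < n → m + 1 ≤ c.travel → c.travel < n →
    T = c.A n T c.travel → T ≤ D →
    (∀ T', T ≤ T' → T' ≤ 2 ^ (m + 2) - 2 + D → c.B n T' m = D) →
    (∀ j ≤ m, c.a j = .board) → (∀ j < m, c.stays j = true) →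
    (∀ j ≤ m, Edge.enter j ∉ S ∧ Edge.skip j ∉ S) →
    Frame n (2 * m + 2) c S T (2 ^ (m + 2) - 2 + D) →
    Leads n N c S (Climbed m c S)

theorem count_zero {N : ℕ} (h : IncrementSpec n 0 N) : CountSpec n 0 N := by
  intro c S D T hm ht htr hT hTD hB hb _ hclean hF
  have hA : c.A n T 0 = T - 2 + 5 / 4 := by rw [Config.A_of_board hm (hb 0 le_rfl)]; norm_num
  refine h c S D T hm htr hT (by norm_num; linarith) hB ⟨fun j hj => by omega, fun j hj => by omega⟩
    (fun m hm => by omega) (fun _ => ⟨ht, hTD⟩) (by linarith) (by linarith) (fun _ => by linarith)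
    (by rw [hb 0 le_rfl]; simp) ?_ (by rw [hb 0 le_rfl]; simp) hF
  intro e he hr
  rcases Edge.eq_of_rank_odd hr with rfl | rfl | rfl
  · exact absurd he (hclean 0 le_rfl).1
  · exact absurd he (hclean 0 le_rfl).2
  · exact hb 0 le_rfl

/-- The vertices of the levels up to `m` come first, so level `m + 1` is entered after all of these
levels. -/
theorem count_succ {m N M : ℕ} (h : CountSpec n m N) (h' : IncrementSpec n (m + 1) M) :
    CountSpec n (m + 1) (N + M) := by
  intro c S D T hm ht htr hT hTD hB hb hs hclean hF
  have hpow := two_le_two_pow m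
  have hpow2 : (2 : ℝ) ^ (m + 2) = 2 * 2 ^ (m + 1) := by ring
  have hpow3 : (2 : ℝ) ^ (m + 1 + 1) = 2 * 2 ^ (m + 1) := by ring
  have hpow4 : (2 : ℝ) ^ (m + 1 + 2) = 4 * 2 ^ (m + 1) := by ring
  have hbm := hb (m + 1) le_rfl
  have hA : ∀ T', c.A n T' (m + 1) = T' - 2 * 2 ^ (m + 1) + 5 / 4 := fun T' => by
    rw [Config.A_of_board hm hbm]; ring
  have hBm : ∀ T', T ≤ T' → T' ≤ 2 ^ (m + 1 + 2) - 2 + D → c.B n T' m = D + 3 / 4 :=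
    fun T' u v => by rw [Config.B_of_stay (by omega) (hs m (by omega)), hB T' u v]; ring
  have hle : 2 ^ (m + 2) - 2 + (D + 3 / 4) ≤ 2 ^ (m + 1 + 2) - 2 + D := by linarith
  refine (h c S (D + 3 / 4) T (by omega) (by omega) htr hT (by linarith)
    (fun T' u v => hBm T' u (v.trans hle)) (fun j hj => hb j (by omega))
    (fun j hj => hs j (by omega)) (fun j hj => hclean j (by omega))
    ⟨fun T' j u v hj hp => ?_, fun e he hl hr T' u v => ?_⟩).trans ?_
  · rcases (show j = m + 1 ∨ m + 1 < j by omega) with rfl | h1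
    · rw [hA]; linarith
    · exact hF.le T' j u (v.trans hle) hj (by omega)
  · rcases (show e.rank = 2 * m + 2 ∨ e.rank = 2 * (m + 1) + 1 ∨ 2 * (m + 1) + 2 ≤ e.rank by omega)
      with h1 | h1 | h1
    · rcases Edge.eq_of_rank_even h1 with rfl | rfl
      · exact (Config.z_of_active hl (by omega) (hs m (by omega))).le
      · simp only [Config.z]; rw [hA, hBm T' u (v.trans hle)]; linarith
    · rcases Edge.eq_of_rank_odd h1 with rfl | rfl | rfl
      · exact absurd he (hclean (m + 1) le_rfl).1
      · exact absurd he (hclean (m + 1) le_rfl).2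
      · exact (Config.z_of_active hl (by omega) hbm).le
    · exact hF.stale e he hl h1 T' u (v.trans hle)
  rintro c1 S1 ⟨hE, ht1, hC1⟩
  have hbm1 : c1.a (m + 1) = .board := (hE.agree.1 (m + 1) (by omega)).trans hbm
  have hsm1 : ∀ m', m' + 1 = m + 1 → c1.stays m' = true := fun m' h => by
    obtain rfl : m' = m := by omega
    rw [hE.agree.2 m' (by omega)]
    exact hs m' (by omega)
  have hle0 : T ≤ 2 ^ (m + 2) - 2 + (D + 3 / 4) := by linarith
  set T1 : ℝ := 2 ^ (m + 2) - 2 + (D + 3 / 4) with hT1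
  have hB1 : ∀ T', T1 ≤ T' → T' ≤ 2 ^ (m + 1 + 2) - 2 + D → c1.B n T' (m + 1) = D :=
    fun T' u v => by rw [hE.agree.B_eq hm.le (by omega), hB T' (hle0.trans u) v]
  have hA1 : c1.A n T1 (m + 1) = T1 - 2 * 2 ^ (m + 1) + 5 / 4 := by
    rw [hE.agree.A_eq hm.le (by omega), hA]
  refine (h' c1 S1 D T1 hm (ht1 ▸ by omega) ?_ hle hB1 hC1 (fun m' h => ⟨hsm1 m' h, ht1⟩)
    (fun h => by omega) (by linarith) (by linarith) (fun _ => by linarith) (by rw [hbm1]; simp)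
    ?_ (by rw [hbm1]; simp) (hF.ext (hE.mono (by omega)) (by omega) le_rfl hle0 le_rfl)).imp ?_
  · rw [ht1, hC1.A_eq_of_stay hsm1 hm (hB1 T1 le_rfl hle) (by omega)]
    norm_num
    linarith
  · intro e he hr
    have h1 := hE.sub e he (by omega)
    rcases Edge.eq_of_rank_odd hr with rfl | rfl | rfl
    · exact absurd h1 (hclean (m + 1) le_rfl).1
    · exact absurd h1 (hclean (m + 1) le_rfl).2
    · exact hbm1
  · rintro c' S' ⟨h1, h2, h3⟩
    exact ⟨(hE.mono (by omega)).trans h1, h2, h3⟩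

/-! ### Resets: boarding the transportation vertex -/

/-- The conditions on the levels from `m + 1` on during a reset of the levels up to `m`. -/
structure Outer (n m : ℕ) (c : Config) (S : Set Edge) (D : ℝ) : Prop where
  lt : m + 1 < n
  enters : c.a (m + 1) = .enter
  B_eq : ∀ T, 2 ^ (m + 2) + D ≤ T → T ≤ 2 ^ (m + 3) - 2 + D → c.B n T (m + 1) = D
  frame : Frame n (2 * m + 3) c S (2 ^ (m + 2) + D) (2 ^ (m + 3) - 2 + D)

theorem Outer.ext (h : Outer n m c S D) (h' : Ext (2 * m + 3) c S c' S') : Outer n m c' S' D where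
  lt := h.lt
  enters := (h'.agree.1 (m + 1) (by omega)).trans h.enters
  B_eq T a b := by rw [h'.agree.B_eq h.lt.le (by omega), h.B_eq T a b]
  frame := h.frame.ext h' (by omega) le_rfl le_rfl le_rfl

theorem Outer.A_eq (h : Outer n m c S D) (h₀ : 2 ^ (m + 2) + D ≤ T) (h₁ : T ≤ 2 ^ (m + 3) - 2 + D) :
    c.A n T (m + 1) = 2 ^ (m + 2) + D := by
  rw [Config.A_of_enter h.lt h.enters, h.B_eq T h₀ h₁]

theorem Outer.le_max (D : ℝ) (m : ℕ) : (2 : ℝ) ^ (m + 2) + D ≤ 2 ^ (m + 3) - 2 + D := by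
  have h1 := two_le_two_pow (m + 1)
  have h2 : (2 : ℝ) ^ (m + 3) = 2 * 2 ^ (m + 1 + 1) := by ring
  have h3 : (2 : ℝ) ^ (m + 2) = 2 ^ (m + 1 + 1) := by ring
  linarith

/-- The state in a reset of the levels up to `m` in which the levels below `j` are boarded and the
others are still entered. -/
structure Boarding (n m j : ℕ) (c : Config) (S : Set Edge) (D : ℝ) : Prop extends
    Outer n m c S D where
  travel : c.travel = m + 1
  boards : ∀ i < j, c.a i = .board
  enters' : ∀ i, j ≤ i → i ≤ m → c.a i = .enter
  leaves : ∀ i < m, c.stays i = false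
  stays : c.stays m = true
  prepared : ∀ e ∈ S, 1 ≤ e.rank → e.rank < 2 * m + 3 →
    c.Active e ∨ ∃ i, i + 1 = j ∧ e = .enter i

namespace Boarding

theorem B_last (h : Boarding n m j c S D) (h₀ : 2 ^ (m + 2) + D ≤ T)
    (h₁ : T ≤ 2 ^ (m + 3) - 2 + D) : c.B n T m = 3 / 4 + D := by
  have := h.lt
  rw [Config.B_of_stay (by omega) h.stays, h.B_eq T h₀ h₁]

theorem A_enter (h : Boarding n m j c S D) : ∀ l i, i + l = m → j ≤ i →
    c.A n (2 ^ (m + 2) + D) i = 2 ^ (m + 2) + D + 3 / 4 - 2 ^ (i + 1) := by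
  have hlt := h.lt
  intro l
  induction l with
  | zero =>
    intro i hi hj
    obtain rfl : i = m := by omega
    rw [Config.A_of_enter (by omega) (h.enters' i hj le_rfl), h.B_last le_rfl (Outer.le_max D i)]
    ring
  | succ l ih =>
    intro i hi hj
    rw [Config.A_of_enter (by omega) (h.enters' i hj (by omega)),
      Config.B_of_leave (by omega) (h.leaves i (by omega)), ih (i + 1) (by omega) (by omega)]
    ring

theorem A_board (h : Boarding n m j c S D) (hj : j ≤ m) {i : ℕ} (hi : i < j) :
    c.A n T i = T - 2 ^ (i + 1) + 5 / 4 := by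
  have hlt := h.lt
  rw [Config.A_of_board (by omega) (h.boards i hi)]

theorem A_le (h : Boarding n m j c S D) (hj : j ≤ m) {i : ℕ} (hi : i < n) :
    c.A n (2 ^ (m + 2) + D) i ≤ 2 ^ (m + 2) + D := by
  have hpow := two_le_two_pow i
  rcases (show i < j ∨ (j ≤ i ∧ i ≤ m) ∨ m + 1 ≤ i by omega) with h1 | h1 | h1
  · rw [h.A_board hj h1]; linarith
  · rw [h.A_enter (m - i) i (by omega) h1.1]; linarith
  · exact h.frame.le _ i le_rfl (Outer.le_max D m) hi.le (by omega)

/-- No edge that starts before `a j` is improving. The edge `enter (j - 1)`, which is the only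
inactive edge of the levels up to `m` that may be prepared, even has negative reduced costs, so that
it is reset before the next switch. -/
theorem z_le (h : Boarding n m j c S D) (hj : j ≤ m) (he : e.level < n) (hr : e.rank < 2 * j + 1) :
    c.z n (2 ^ (m + 2) + D) e ≤ 0 ∧
      ∀ i, i + 1 = j → e = .enter i → c.z n (2 ^ (m + 2) + D) e < 0 := by
  have hlt := h.lt
  have hA : ∀ i ≤ j, c.A n (2 ^ (m + 2) + D) i ≤ 2 ^ (m + 2) + D + 5 / 4 - 2 ^ (i + 1) ∧
      2 ^ (m + 2) + D + 3 / 4 - 2 ^ (i + 1) ≤ c.A n (2 ^ (m + 2) + D) i := by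
    intro i hi
    rcases (show i < j ∨ i = j by omega) with h1 | rfl
    · rw [h.A_board hj h1]; constructor <;> linarith
    · rw [h.A_enter (m - i) i (by omega) le_rfl]; constructor <;> linarith
  cases e <;> simp only [Edge.rank, Edge.level] at he hr <;> simp only [Config.z]
  case travel i =>
    exact ⟨by linarith [h.A_le hj he], by simp⟩
  case enter i =>
    rw [Config.B_of_leave (by omega) (h.leaves i (by omega)), h.A_board hj (i := i) (by omega)]
    have h2 : (2 : ℝ) ^ (i + 1 + 1) = 2 * 2 ^ (i + 1) := by ring
    refine ⟨?_, fun i' hi' hii' => ?_⟩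
    · linarith [(hA (i + 1) (by omega)).1]
    · obtain rfl : i = i' := by simpa using hii'
      rw [h.A_enter (m - (i + 1)) (i + 1) (by omega) (by omega)]
      linarith
  case skip i =>
    rw [h.A_board hj (i := i) (by omega)]
    have h1 := two_le_two_pow i
    have h2 : (2 : ℝ) ^ (i + 1 + 1) = 2 * 2 ^ (i + 1) := by ring
    exact ⟨by linarith [(hA (i + 1) (by omega)).1], by simp⟩
  case board i =>
    rw [h.A_board hj (i := i) (by omega)]
    exact ⟨by linarith, by simp⟩
  case stay i =>
    refine ⟨?_, by simp⟩
    rw [Config.B_of_leave (by omega) (h.leaves i (by omega))]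
    have h1 := two_le_two_pow i
    have h2 : (2 : ℝ) ^ (i + 1 + 1) = 2 * 2 ^ (i + 1) := by ring
    have h3 : (2 : ℝ) ^ (i + 1 + 1 + 1) = 4 * 2 ^ (i + 1) := by ring
    have h4 := (hA (i + 1) (by omega)).2
    rcases (show i + 1 < m ∨ i + 1 = m by omega) with h5 | rfl
    · rw [Config.B_of_leave (by omega) (h.leaves (i + 1) h5)]
      have h6 : c.A n (2 ^ (m + 2) + D) (i + 1 + 1) ≤
          2 ^ (m + 2) + D + 5 / 4 - 2 ^ (i + 1 + 1 + 1) := by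
        rcases (show i + 1 + 1 ≤ j ∨ j ≤ i + 1 + 1 by omega) with h7 | h7
        · exact (hA _ h7).1
        · rw [h.A_enter (m - (i + 1 + 1)) _ (by omega) h7]; linarith
      linarith
    · rw [Config.A_of_enter (by omega) (h.enters' (i + 1) (by omega) le_rfl)]
      linarith
  case leave i =>
    rw [Config.B_of_leave (by omega) (h.leaves i (by omega))]
    exact ⟨by linarith, by simp⟩

theorem value_t (h : Boarding n m j c S D) :
    2 ^ (m + 2) + D = c.A n (2 ^ (m + 2) + D) c.travel := by
  rw [h.travel, h.A_eq le_rfl (Outer.le_max D m)]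

theorem stale (h : Boarding n m j c S D) (he : e ∈ S) (hl : e.level < n) (h₁ : 2 * j + 1 ≤ e.rank)
    (h₂ : e.rank < 2 * m + 3) : c.z n (2 ^ (m + 2) + D) e ≤ 0 := by
  rcases h.prepared e he (by omega) h₂ with h3 | ⟨i, hi, rfl⟩
  · exact (Config.z_of_active hl (by omega) h3).le
  · simp only [Edge.rank] at h₁; omega

/-- Boarding gives level `j` a gain of `1 / 2` over entering it. -/
theorem step (h : Boarding n m j c S D) (hj : j < m) : Leads n 0 c S fun c' S' =>
    Ext (2 * m + 3) c S c' S' ∧ Boarding n m (j + 1) c' S' D := by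
  have hlt := h.lt
  have hAj := h.A_enter (m - j) j (by omega) le_rfl
  have hAj1 := h.A_enter (m - (j + 1)) (j + 1) (by omega) (by omega)
  have hpow := two_le_two_pow j
  have hpow2 : (2 : ℝ) ^ (j + 1 + 1) = 2 * 2 ^ (j + 1) := by ring
  refine .weaken (Nat.zero_le (0 + 1)) (.step (T := 2 ^ (m + 2) + D) (e := .board j)
    (Ready.of_frame h.frame le_rfl (Outer.le_max D m) (by rw [h.travel]; exact hlt) h.value_t
      (show j < n by omega) ?_ (fun e he hr => (h.z_le hj.le he hr).1) ?_
      (fun e he hl h₁ h₂ => h.stale he hl h₁ h₂)) ?_)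
  · simp only [Config.z]; rw [hAj]; linarith
  · intro e he hr hne
    rcases Edge.eq_of_rank_odd hr with rfl | rfl | rfl
    · rw [Config.z_of_active (e := .enter j) he (by simp [Edge.rank]) (h.enters' j le_rfl hj.le)]
      exact ⟨by simp only [Config.z]; rw [hAj]; linarith, fun h => absurd h (lt_irrefl _)⟩
    · simp only [Config.z]
      rw [hAj, hAj1]
      exact ⟨by linarith, fun _ => by linarith⟩
    · exact absurd rfl hne
  intro S' hS'
  have hE : Ext (2 * m + 3) c S (c.switch (.board j)) S' :=
    Ext.switch (show 2 * j + 1 < _ by omega) hS'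
  have ha : ∀ i, i ≠ j → (c.switch (.board j)).a i = c.a i := fun i hi => by
    simp [Config.switch, Function.update_of_ne hi]
  have haj : (c.switch (.board j)).a j = .board := by simp [Config.switch]
  refine .done ⟨hE, h.toOuter.ext hE, h.travel, fun i hi => ?_, fun i hi hi' => ?_, h.leaves,
    h.stays, fun e he h1 h2 => ?_⟩
  · rcases (show i < j ∨ i = j by omega) with h1 | rfl
    · rw [ha i (by omega), h.boards i h1]
    · exact haj
  · rw [ha i (by omega), h.enters' i (by omega) hi']
  · rcases hS' e he with rfl | ⟨h3, h4⟩
    · exact .inl haj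
    rcases h.prepared e h3 h1 h2 with h5 | ⟨i, hi, rfl⟩
    · by_cases hr : e.rank = 2 * j + 1
      · have h6 := h.enters' j le_rfl hj.le
        rcases Edge.eq_of_rank_odd hr with rfl | rfl | rfl
        · exact .inr ⟨j, rfl, rfl⟩
        · exact absurd (h6.symm.trans h5) (by simp)
        · exact .inl haj
      · left
        cases e <;> simp only [Edge.rank] at h1 hr <;> simp only [Config.Active] at h5 ⊢
        case travel => omega
        case stay => exact h5
        case leave => exact h5
        all_goals exact (ha _ (by omega)).trans h5
    · have hl : (Edge.enter i).level < n := show i < n by omega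
      have hr : (Edge.enter i).rank < (Edge.board j).rank := show 2 * i + 1 < 2 * j + 1 by omega
      exact absurd (h4 hl hr) ((h.z_le hj.le hl hr).2 i hi rfl).ne

theorem steps (h : Boarding n m 0 c S D) : ∀ j ≤ m, Leads n 0 c S fun c' S' =>
    Ext (2 * m + 3) c S c' S' ∧ Boarding n m j c' S' D := by
  intro j
  induction j with
  | zero => exact fun _ => .done ⟨.refl, h⟩
  | succ j ih =>
    intro hj
    refine (ih (by omega)).trans (M := 0) fun c' S' ⟨hE, h'⟩ => ?_
    exact (h'.step (by omega)).imp fun c'' S'' h'' => ⟨hE.trans h''.1, h''.2⟩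

end Boarding

/-- The state in a reset of the levels up to `m` in which level `m` is skipped, the lower levels are
boarded, and the `b`-vertices from level `j` to level `m - 2` have been switched back to `stay`. -/
structure Staying (n m j : ℕ) (c : Config) (S : Set Edge) (D : ℝ) : Prop extends
    Outer n m c S D where
  travel : c.travel = m + 1
  not_mem : m = 0 → Edge.travel 0 ∉ S
  boards : ∀ i < m, c.a i = .board
  skips : c.a m = .skip
  leaves : ∀ i < j, c.stays i = false
  leaves_last : ∀ i, i + 1 = m → c.stays i = false
  stays' : ∀ i, j ≤ i → i + 1 < m → c.stays i = true
  stays : c.stays m = true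
  prepared : ∀ e ∈ S, 1 ≤ e.rank → e.rank < 2 * m + 3 →
    c.Active e ∨ e = .enter m ∨ ∃ i, j ≤ i ∧ i + 1 < m ∧ e = .leave i

/-- Skipping is the best choice for `a m`: boarding leads to `a (m + 1)` as well, but via `t` and at
a cost. -/
theorem Boarding.skip (h : Boarding n m m c S D) : Leads n 0 c S fun c' S' =>
    Ext (2 * m + 3) c S c' S' ∧ Staying n m (m - 1) c' S' D := by
  have hlt := h.lt
  have hAm := h.A_enter 0 m (by omega) le_rfl
  have hAm1 := h.A_eq le_rfl (Outer.le_max D m)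
  have hpow := two_le_two_pow m
  refine .weaken (Nat.zero_le (0 + 1)) (.step (T := 2 ^ (m + 2) + D) (e := .skip m)
    (Ready.of_frame h.frame le_rfl (Outer.le_max D m) (by rw [h.travel]; exact hlt) h.value_t
      (show m < n by omega) ?_ (fun e he hr => (h.z_le le_rfl he hr).1) ?_
      (fun e he hl h₁ h₂ => h.stale he hl h₁ h₂)) ?_)
  · simp only [Config.z]; rw [hAm, hAm1]; linarith
  · intro e he hr hne
    rcases Edge.eq_of_rank_odd hr with rfl | rfl | rfl
    · rw [Config.z_of_active (e := .enter m) he (by simp [Edge.rank]) (h.enters' m le_rfl le_rfl)]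
      exact ⟨by simp only [Config.z]; rw [hAm, hAm1]; linarith, fun h => absurd h (lt_irrefl _)⟩
    · exact absurd rfl hne
    · simp only [Config.z]
      rw [hAm, hAm1]
      exact ⟨by linarith, fun _ => by simp [Edge.prio]⟩
  intro S' hS'
  have hE : Ext (2 * m + 3) c S (c.switch (.skip m)) S' :=
    Ext.switch (show 2 * m + 1 < _ by omega) hS'
  have ha : ∀ i, i ≠ m → (c.switch (.skip m)).a i = c.a i := fun i hi => by
    simp [Config.switch, Function.update_of_ne hi]
  have ham : (c.switch (.skip m)).a m = .skip := by simp [Config.switch]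
  refine .done ⟨hE, h.toOuter.ext hE, h.travel, fun h0 h1 => ?_, fun i hi => ?_, ham,
    fun i hi => h.leaves i (by omega), fun i hi => h.leaves i (by omega),
    fun i hi hi' => by omega, h.stays, fun e he h1 h2 => ?_⟩
  · subst h0
    rcases hS' _ h1 with h2 | ⟨-, h3⟩
    · cases h2
    · have h4 := h3 (show 0 < n by omega) (by simp [Edge.rank])
      simp only [Config.z] at h4
      rw [hAm] at h4
      linarith
  · rw [ha i (by omega), h.boards i hi]
  · rcases hS' e he with rfl | ⟨h3, h4⟩
    · exact .inl ham
    rcases h.prepared e h3 h1 h2 with h5 | ⟨i, hi, rfl⟩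
    · by_cases hr : e.rank = 2 * m + 1
      · have h6 := h.enters' m le_rfl le_rfl
        rcases Edge.eq_of_rank_odd hr with rfl | rfl | rfl
        · exact .inr (.inl rfl)
        · exact .inl ham
        · exact absurd (h6.symm.trans h5) (by simp)
      · left
        cases e <;> simp only [Edge.rank] at h1 hr <;> simp only [Config.Active] at h5 ⊢
        case travel => omega
        case stay => exact h5
        case leave => exact h5
        all_goals exact (ha _ (by omega)).trans h5
    · have hl : (Edge.enter i).level < n := show i < n by omega
      have hr : (Edge.enter i).rank < (Edge.skip m).rank := show 2 * i + 1 < 2 * m + 1 by omega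
      exact absurd (h4 hl hr) ((h.z_le le_rfl hl hr).2 i hi rfl).ne

namespace Staying

theorem A_last (h : Staying n m j c S D) (h₀ : 2 ^ (m + 2) + D ≤ T)
    (h₁ : T ≤ 2 ^ (m + 3) - 2 + D) : c.A n T m = 2 ^ (m + 2) + D := by
  have hlt := h.lt
  rw [Config.A_of_skip (by omega) h.skips, h.A_eq h₀ h₁]

theorem B_last (h : Staying n m j c S D) (h₀ : 2 ^ (m + 2) + D ≤ T)
    (h₁ : T ≤ 2 ^ (m + 3) - 2 + D) : c.B n T m = 3 / 4 + D := by
  have hlt := h.lt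
  rw [Config.B_of_stay (by omega) h.stays, h.B_eq T h₀ h₁]

theorem A_board (h : Staying n m j c S D) {i : ℕ} (hi : i < m) :
    c.A n T i = T - 2 ^ (i + 1) + 5 / 4 := by
  have hlt := h.lt
  rw [Config.A_of_board (by omega) (h.boards i hi)]

theorem A_le (h : Staying n m j c S D) {i : ℕ} (hi : i < n) :
    c.A n (2 ^ (m + 2) + D) i ≤ 2 ^ (m + 2) + D := by
  have hpow := two_le_two_pow i
  rcases (show i < m ∨ i = m ∨ m + 1 ≤ i by omega) with h1 | rfl | h1
  · rw [h.A_board h1]; linarith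
  · rw [h.A_last le_rfl (Outer.le_max D i)]
  · exact h.frame.le _ i le_rfl (Outer.le_max D m) hi.le (by omega)

theorem le_B (h : Staying n m j c S D) : ∀ l i, i + l + 1 = m → j ≤ i →
    2 ^ (m + 2) + D ≤ c.B n (2 ^ (m + 2) + D) i := by
  have hlt := h.lt
  intro l
  induction l with
  | zero =>
    intro i hi hj
    rw [Config.B_of_leave (by omega) (h.leaves_last i hi), show i + 1 = m by omega,
      h.A_last le_rfl (Outer.le_max D m)]
  | succ l ih =>
    intro i hi hj
    rw [Config.B_of_stay (by omega) (h.stays' i hj (by omega))]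
    linarith [ih (i + 1) (by omega) (by omega)]

theorem value_t (h : Staying n m j c S D) :
    2 ^ (m + 2) + D = c.A n (2 ^ (m + 2) + D) c.travel := by
  rw [h.travel, h.A_eq le_rfl (Outer.le_max D m)]

/-- The edge `enter m` may still be prepared, but it is not improving until `b m` switches to
`leave`. -/
theorem enter_neg (h : Staying n m j c S D) (h₀ : 2 ^ (m + 2) + D ≤ T)
    (h₁ : T ≤ 2 ^ (m + 3) - 2 + D) : c.z n T (.enter m) < 0 := by
  have h1 := two_le_two_pow m
  have h2 : (2 : ℝ) ^ (m + 2) = 2 * 2 ^ (m + 1) := by ring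
  simp only [Config.z]
  rw [h.A_last h₀ h₁, h.B_last h₀ h₁]
  linarith

theorem step (h : Staying n m (j + 1) c S D) (hj : j + 1 < m) : Leads n 0 c S fun c' S' =>
    Ext (2 * m + 3) c S c' S' ∧ Staying n m j c' S' D := by
  have hlt := h.lt
  have hA : ∀ i ≤ j + 1, c.A n (2 ^ (m + 2) + D) i = 2 ^ (m + 2) + D - 2 ^ (i + 1) + 5 / 4 :=
    fun i hi => h.A_board (by omega)
  have hB : ∀ i ≤ j, c.B n (2 ^ (m + 2) + D) i = 2 ^ (m + 2) + D - 2 ^ (i + 2) + 5 / 4 := by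
    intro i hi
    rw [Config.B_of_leave (by omega) (h.leaves i (by omega)), hA (i + 1) (by omega)]
  have hle := h.le_B (m - (j + 1) - 1) (j + 1) (by omega) le_rfl
  refine .weaken (Nat.zero_le (0 + 1)) (.step (T := 2 ^ (m + 2) + D) (e := .stay j)
    (Ready.of_frame h.frame le_rfl (Outer.le_max D m) (by rw [h.travel]; exact hlt) h.value_t
      (show j < n by omega) ?_ ?_ ?_ ?_) ?_)
  · have := two_le_two_pow (j + 1)
    simp only [Config.z]; rw [hB j le_rfl]; linarith
  · intro e he hr
    cases e <;> simp only [Edge.rank, Edge.level] at he hr <;> simp only [Config.z]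
    case travel i => linarith [h.A_le he]
    case enter i =>
      rw [hA i (by omega), hB i (by omega)]
      have h2 : (2 : ℝ) ^ (i + 2) = 2 * 2 ^ (i + 1) := by ring
      linarith
    case skip i =>
      rw [hA i (by omega), hA (i + 1) (by omega)]
      have h2 : (2 : ℝ) ^ (i + 1 + 1) = 2 * 2 ^ (i + 1) := by ring
      have := two_le_two_pow i
      linarith
    case board i => rw [hA i (by omega)]; linarith
    case stay i =>
      rw [hB i (by omega), hB (i + 1) (by omega)]
      have h2 : (2 : ℝ) ^ (i + 1 + 2) = 4 * 2 ^ (i + 1) := by ring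
      have h3 : (2 : ℝ) ^ (i + 2) = 2 * 2 ^ (i + 1) := by ring
      have := two_le_two_pow i
      linarith
    case leave i =>
      rw [hB i (by omega), hA (i + 1) (by omega)]
      linarith
  · intro e he hr hne
    rcases Edge.eq_of_rank_even hr with rfl | rfl
    · exact absurd rfl hne
    · rw [Config.z_of_active (e := .leave j) he (by simp [Edge.rank]) (h.leaves j (by omega))]
      have := two_le_two_pow (j + 1)
      exact ⟨by simp only [Config.z]; rw [hB j le_rfl]; linarith, fun h => absurd h (lt_irrefl _)⟩
  · intro e he hl h₁ h₂
    have h₁ : 2 * j + 2 ≤ e.rank := h₁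
    rcases h.prepared e he (by omega) h₂ with h3 | rfl | ⟨i, hi, hi', rfl⟩
    · exact (Config.z_of_active hl (by omega) h3).le
    · exact (h.enter_neg le_rfl (Outer.le_max D m)).le
    · have := two_le_two_pow (i + 1)
      simp only [Config.z]
      rw [h.A_board (by omega)]
      linarith [h.le_B (m - i - 1) i (by omega) hi]
  intro S' hS'
  have hE : Ext (2 * m + 3) c S (c.switch (.stay j)) S' :=
    Ext.switch (show 2 * j + 2 < _ by omega) hS'
  have hs : ∀ i, i ≠ j → (c.switch (.stay j)).stays i = c.stays i := fun i hi => by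
    simp [Config.switch, Function.update_of_ne hi]
  have hsj : (c.switch (.stay j)).stays j = true := by simp [Config.switch]
  refine .done ⟨hE, h.toOuter.ext hE, h.travel, fun h0 => by omega, h.boards, h.skips,
    fun i hi => (hs i (by omega)).trans (h.leaves i (by omega)),
    fun i hi => (hs i (by omega)).trans (h.leaves_last i hi), fun i hi hi' => ?_,
    (hs m (by omega)).trans h.stays, fun e he h1 h2 => ?_⟩
  · rcases (show i = j ∨ j + 1 ≤ i by omega) with rfl | h1
    · exact hsj
    · exact (hs i (by omega)).trans (h.stays' i h1 hi')
  · rcases hS' e he with rfl | ⟨h3, -⟩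
    · exact .inl hsj
    rcases h.prepared e h3 h1 h2 with h5 | rfl | ⟨i, hi, hi', rfl⟩
    · by_cases hr : e.rank = 2 * j + 2
      · rcases Edge.eq_of_rank_even hr with rfl | rfl
        · exact .inl hsj
        · exact .inr (.inr ⟨j, le_rfl, hj, rfl⟩)
      · left
        cases e <;> simp only [Edge.rank] at h1 hr <;> simp only [Config.Active] at h5 ⊢
        case travel => omega
        case stay => exact (hs _ (by omega)).trans h5
        case leave => exact (hs _ (by omega)).trans h5
        all_goals exact h5
    · exact .inr (.inl rfl)
    · exact .inr (.inr ⟨i, by omega, hi', rfl⟩)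

theorem steps : ∀ j c S, j + 1 ≤ m ∨ j = 0 → Staying n m j c S D → Leads n 0 c S fun c' S' =>
    Ext (2 * m + 3) c S c' S' ∧ Staying n m 0 c' S' D := by
  intro j
  induction j with
  | zero => exact fun c S _ h => .done ⟨.refl, h⟩
  | succ j ih =>
    intro c S hj h
    refine (h.step (by omega)).trans (M := 0) fun c' S' ⟨hE, h'⟩ => ?_
    exact (ih c' S' (by omega) h').imp fun c'' S'' h'' => ⟨hE.trans h''.1, h''.2⟩

end Staying

/-- The state in a reset of the levels up to `m` in which the levels below `m` have been entered and
left again, and `b m` is the next vertex with an improving switch. -/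
structure Leaving (n m : ℕ) (c : Config) (S : Set Edge) (D : ℝ) : Prop extends
    Outer n m c S D where
  travel : 0 < m → c.travel = 0
  travel' : m = 0 → c.travel = 1 ∧ Edge.travel 0 ∉ S
  enters' : ∀ i < m, c.a i = .enter
  leaves : ∀ i < m, c.stays i = false
  skips : c.a m = .skip
  stays : c.stays m = true
  prepared : ∀ e ∈ S, 2 * m + 1 ≤ e.rank → e.rank < 2 * m + 3 → c.Active e ∨ e = .enter m

theorem Staying.toLeaving {N : ℕ} (h : Staying n m 0 c S D)
    (hN : ∀ m', m' + 1 = m → CountSpec n m' N) (hN' : m = 0 → N = 0) :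
    Leads n N c S fun c' S' => Ext (2 * m + 3) c S c' S' ∧ Leaving n m c' S' D := by
  have hlt := h.lt
  rcases m with - | m
  · rw [hN' rfl]
    exact .done ⟨.refl, h.toOuter, by simp, fun _ => ⟨h.travel, h.not_mem rfl⟩, by simp, by simp,
      h.skips, h.stays, fun e he h1 h2 =>
        (h.prepared e he (by omega) h2).imp_right fun h3 => h3.resolve_right
          (by rintro ⟨i, hi, hi', -⟩; omega)⟩
  have hpow := two_le_two_pow m
  have hpow3 : (2 : ℝ) ^ (m + 1 + 2) = 4 * 2 ^ (m + 1) := by ring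
  have hpow4 : (2 : ℝ) ^ (m + 1 + 3) = 8 * 2 ^ (m + 1) := by ring
  have hpow2 : (2 : ℝ) ^ (m + 2) = 2 * 2 ^ (m + 1) := by ring
  have hle : 2 ^ (m + 2) - 2 + (2 ^ (m + 1 + 2) + D) ≤ 2 ^ (m + 1 + 3) - 2 + D := by linarith
  refine (hN m rfl c S (2 ^ (m + 1 + 2) + D) (2 ^ (m + 1 + 2) + D) (by omega)
    (by rw [h.travel]; omega) (by rw [h.travel]; exact hlt) h.value_t le_rfl (fun T' u v => ?_)
    (fun i hi => h.boards i (by omega)) (fun i hi => h.stays' i (by omega) (by omega))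
    (fun i hi => ?_) ⟨fun T' i u v hi hi' => ?_, fun e he hl h1 T' u v => ?_⟩).imp ?_
  · rw [Config.B_of_leave (by omega) (h.leaves_last m rfl), h.A_last u (v.trans hle)]
  · have hb := h.boards i (by omega)
    constructor <;> intro he <;>
    · rcases h.prepared _ he (by simp [Edge.rank]) (by simp only [Edge.rank]; omega) with
        h1 | h1 | ⟨i', -, -, h1⟩
      · exact absurd (hb.symm.trans h1) (by simp)
      · injection h1 <;> omega
      · cases h1
  · rcases (show i = m + 1 ∨ m + 1 + 1 ≤ i by omega) with rfl | h1
    · rw [h.A_last u (v.trans hle)]; exact u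
    · exact h.frame.le T' i u (v.trans hle) hi (by omega)
  · rcases (show e.rank < 2 * (m + 1) + 3 ∨ 2 * (m + 1) + 3 ≤ e.rank by omega) with h2 | h2
    · rcases h.prepared e he (by omega) h2 with h3 | rfl | ⟨i, -, hi, rfl⟩
      · exact (Config.z_of_active hl (by omega) h3).le
      · exact (h.enter_neg u (v.trans hle)).le
      · simp only [Edge.rank] at h1; omega
    · exact h.frame.stale e he hl h2 T' u (v.trans hle)
  · rintro c' S' ⟨hE, ht, hC⟩
    have hE' : Ext (2 * (m + 1) + 3) c S c' S' := hE.mono (by omega)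
    refine ⟨hE', h.toOuter.ext hE', fun _ => ht, fun h => absurd h (by omega),
      fun i hi => hC.1 i hi, fun i hi => ?_, (hE.agree.1 _ (by omega)).trans h.skips,
      (hE.agree.2 _ (by omega)).trans h.stays, fun e he h1 h2 => ?_⟩
    · rcases (show i + 1 < m + 1 ∨ i = m by omega) with h1 | rfl
      · exact hC.2 i h1
      · exact (hE.agree.2 i (by omega)).trans (h.leaves_last i rfl)
    · rcases h.prepared e (hE.sub e he (by omega)) (by omega) h2 with h3 | h3 | ⟨i, -, hi, rfl⟩
      · left
        cases e <;> simp only [Edge.rank] at h1 <;> simp only [Config.Active] at h3 ⊢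
        case travel => omega
        case stay => exact (hE.agree.2 _ (by omega)).trans h3
        case leave => exact (hE.agree.2 _ (by omega)).trans h3
        all_goals exact (hE.agree.1 _ (by omega)).trans h3
      · exact .inr h3
      · simp only [Edge.rank] at h1; omega

namespace Leaving

theorem value_t (h : Leaving n m c S D) {T : ℝ} (hT : T = 2 ^ (m + 1) - 2 + (2 ^ (m + 2) + D)) :
    T = c.A n T c.travel := by
  have hlt := h.lt
  have hpow := two_le_two_pow m
  have hpow2 : (2 : ℝ) ^ (m + 2) = 2 * 2 ^ (m + 1) := by ring
  have hpow3 : (2 : ℝ) ^ (m + 3) = 4 * 2 ^ (m + 1) := by ring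
  have h1 := h.A_eq (T := T) (by linarith) (by linarith)
  rcases m with - | m
  · rw [(h.travel' rfl).1, h1, hT]; norm_num
  · have hC : Climb (m + 1) c := ⟨h.enters', fun i hi => h.leaves i (by omega)⟩
    rw [h.travel (by omega), hC.A_eq (by omega) m 0 (by omega),
      Config.B_of_leave (by omega) (h.leaves m (by omega)), Config.A_of_skip (by omega) h.skips, h1,
      hT]
    norm_num

theorem A_le (h : Leaving n m c S D) (hT : T = 2 ^ (m + 1) - 2 + (2 ^ (m + 2) + D)) {i : ℕ}
    (hi : i < n) : c.A n T i ≤ T := by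
  have hlt := h.lt
  have hpow := two_le_two_pow m
  have hpow2 : (2 : ℝ) ^ (m + 2) = 2 * 2 ^ (m + 1) := by ring
  have hpow3 : (2 : ℝ) ^ (m + 3) = 4 * 2 ^ (m + 1) := by ring
  have h1 := h.A_eq (T := T) (by linarith) (by linarith)
  have h2 : c.A n T m = c.A n T (m + 1) := Config.A_of_skip (by omega) h.skips
  rcases (show i < m ∨ i = m ∨ m + 1 ≤ i by omega) with h3 | rfl | h3
  · obtain ⟨m, rfl⟩ : ∃ m', m = m' + 1 := ⟨m - 1, by omega⟩
    have hC : Climb (m + 1) c := ⟨h.enters', fun i hi => h.leaves i (by omega)⟩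
    have := two_le_two_pow i
    have hpow4 : (2 : ℝ) ^ (m + 1 + 1) = 2 ^ (m + 2) := by ring
    rw [hC.A_eq (by omega) (m - i) i (by omega),
      Config.B_of_leave (by omega) (h.leaves m (by omega)), h2, h1]
    linarith
  · rw [h2, h1]; linarith
  · exact h.frame.le T i (by linarith) (by linarith) hi.le (by omega)

theorem neg_or_active (h : Leaving n m c S D) (hT : T = 2 ^ (m + 1) - 2 + (2 ^ (m + 2) + D))
    (he : e.level < n) (h₁ : 1 ≤ e.rank) (h₂ : e.rank < 2 * m + 2) :
    c.z n T e < 0 ∨ c.Active e := by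
  have hlt := h.lt
  have hpow := two_le_two_pow m
  have hpow2 : (2 : ℝ) ^ (m + 2) = 2 * 2 ^ (m + 1) := by ring
  have hpow3 : (2 : ℝ) ^ (m + 3) = 4 * 2 ^ (m + 1) := by ring
  have hu : 2 ^ (m + 2) + D ≤ T := by linarith
  have hv : T ≤ 2 ^ (m + 3) - 2 + D := by linarith
  have h1 := h.A_eq hu hv
  have h2 : c.A n T m = c.A n T (m + 1) := Config.A_of_skip (by omega) h.skips
  have h3 : c.B n T m = 3 / 4 + D := by rw [Config.B_of_stay (by omega) h.stays, h.B_eq T hu hv]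
  rcases (show e.rank < 2 * m + 1 ∨ e.rank = 2 * m + 1 by omega) with h4 | h4
  · obtain ⟨m, rfl⟩ : ∃ m', m = m' + 1 := ⟨m - 1, by omega⟩
    have hC : Climb (m + 1) c := ⟨h.enters', fun i hi => h.leaves i (by omega)⟩
    have h5 : c.B n T m = 2 ^ (m + 1 + 2) + D := by
      rw [Config.B_of_leave (by omega) (h.leaves m (by omega)), h2, h1]
    have hpow4 : (2 : ℝ) ^ (m + 1 + 1) = 2 * 2 ^ (m + 1) := by ring
    have hpow5 : (2 : ℝ) ^ (m + 2) = 2 * 2 ^ (m + 1) := by ring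
    have hpow6 := two_le_two_pow m
    rcases (show e.rank ≤ 2 * m + 1 ∨ e.rank = 2 * m + 2 by omega) with h6 | h6
    · exact hC.neg_or_active (by omega) (by linarith) (by rw [h2]; linarith) he h₁ h6
    · rcases Edge.eq_of_rank_even h6 with rfl | rfl
      · left; simp only [Config.z]; linarith
      · exact .inr (h.leaves m (by omega))
  · rcases Edge.eq_of_rank_odd h4 with rfl | rfl | rfl
    · left; simp only [Config.z]; linarith
    · exact .inr h.skips
    · left; simp only [Config.z]; linarith

/-- `b m` switches to `leave`. This makes `a m` and `b m` agree, and level `m` can be entered. -/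
theorem leads {N : ℕ} (h : Leaving n m c S D) (hN : StayIncrementSpec n m N) :
    Leads n N c S fun c' S' => Ext (2 * m + 3) c S c' S' ∧ c'.travel = 0 ∧
      (∀ j < m + 1, c'.a j = .enter) ∧ ∀ j < m + 1, c'.stays j = false := by
  have hlt := h.lt
  have hpow := two_le_two_pow m
  have hpow2 : (2 : ℝ) ^ (m + 2) = 2 * 2 ^ (m + 1) := by ring
  have hpow3 : (2 : ℝ) ^ (m + 3) = 4 * 2 ^ (m + 1) := by ring
  obtain ⟨T, hT⟩ : ∃ T : ℝ, T = 2 ^ (m + 1) - 2 + (2 ^ (m + 2) + D) := ⟨_, rfl⟩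
  have hu : 2 ^ (m + 2) + D ≤ T := by linarith
  have hv : T ≤ 2 ^ (m + 3) - 2 + D := by linarith
  have h1 := h.A_eq hu hv
  have h2 : c.A n T m = c.A n T (m + 1) := Config.A_of_skip (by omega) h.skips
  have h3 : c.B n T m = 3 / 4 + D := by rw [Config.B_of_stay (by omega) h.stays, h.B_eq T hu hv]
  have htr : c.travel < n := by
    rcases m.eq_zero_or_pos with h4 | h4
    · rw [(h.travel' h4).1]; omega
    · rw [h.travel h4]; omega
  refine .weaken N.le_succ (.step (T := T) (e := .leave m)
    (Ready.of_frame h.frame hu hv htr (h.value_t hT) (show m < n by omega) ?_ ?_ ?_ ?_) ?_)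
  · simp only [Config.z]; linarith
  · intro e he hr
    have hr : e.rank < 2 * m + 2 := hr
    rcases Nat.eq_zero_or_pos e.rank with h4 | h4
    · obtain ⟨i, rfl⟩ := Edge.eq_of_rank_zero h4
      simp only [Config.z]; linarith [h.A_le hT (show i < n from he)]
    · rcases h.neg_or_active hT he h4 hr with h5 | h5
      · exact h5.le
      · exact (Config.z_of_active he h4 h5).le
  · intro e he hr hne
    rcases Edge.eq_of_rank_even hr with rfl | rfl
    · rw [Config.z_of_active (e := .stay m) he (by simp [Edge.rank]) h.stays]
      exact ⟨by simp only [Config.z]; linarith, fun h => absurd h (lt_irrefl _)⟩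
    · exact absurd rfl hne
  · intro e he hl h4 h5
    have h4 : 2 * m + 2 ≤ e.rank := h4
    rcases h.prepared e he (by omega) h5 with h6 | rfl
    · exact (Config.z_of_active hl (by omega) h6).le
    · simp only [Edge.rank] at h4; omega
  intro S' hS'
  have hE : Ext (2 * m + 3) c S (c.switch (.leave m)) S' :=
    Ext.switch (show 2 * m + 2 < _ by omega) hS'
  have hs : ∀ i, i ≠ m → (c.switch (.leave m)).stays i = c.stays i := fun i hi => by
    simp [Config.switch, Function.update_of_ne hi]
  have hsm : (c.switch (.leave m)).stays m = false := by simp [Config.switch]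
  set c' := c.switch (.leave m) with hc'
  have hOut := h.toOuter.ext hE
  have hlow : ∀ e ∈ S', e.level < n → 1 ≤ e.rank → e.rank < 2 * m + 2 → c.Active e := by
    intro e he hl h4 h5
    rcases hS' e he with rfl | ⟨-, h6⟩
    · simp [Edge.rank] at h5
    · exact (h.neg_or_active hT hl h4 h5).resolve_left (h6 hl h5).not_lt
  have hAm : ∀ T', 2 ^ (m + 2) + D ≤ T' → T' ≤ 2 ^ (m + 3) - 2 + D →
      c'.A n T' (m + 1) = 2 ^ (m + 2) + D := fun T' u v => hOut.A_eq u v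
  have hmax : (2 : ℝ) ^ (m + 2) - 2 + (2 ^ (m + 2) + D) = 2 ^ (m + 3) - 2 + D := by linarith
  have hvt : T = c'.A n T c'.travel := by
    rcases m.eq_zero_or_pos with h4 | h4
    · have h5 : c'.travel = 1 := (h.travel' h4).1
      rw [h5, hE.agree.A_eq (by omega) (by omega), ← (h.travel' h4).1]
      exact h.value_t hT
    · obtain ⟨l, rfl⟩ : ∃ l, m = l + 1 := ⟨m - 1, by omega⟩
      have hC : Climb (l + 1) c' :=
        ⟨h.enters', fun i hi => (hs i (by omega)).trans (h.leaves i (by omega))⟩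
      have h5 : c'.travel = 0 := h.travel h4
      rw [h5, hC.A_eq (by omega) l 0 (by omega),
        Config.B_of_leave (by omega) ((hs l (by omega)).trans (h.leaves l (by omega))),
        Config.A_of_skip (c := c') (by omega) h.skips, hAm T hu hv, hT]
      norm_num
  refine (hN c' S' (2 ^ (m + 2) + D) T (by omega) htr hvt (by rw [hmax]; exact hv) h.skips hsm
    (fun T' u v => hAm T' (hu.trans u) (hmax ▸ v)) h.enters'
    (fun i hi => (hs i (by omega)).trans (h.leaves i hi)) h.travel (fun h4 => ?_)
    (fun e he hr => ?_) (fun l hl he => ?_)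
    ⟨fun T' i u v hi hi' => ?_, fun e he hl h4 T' u v => ?_⟩).imp ?_
  · subst h4
    have h5 : c'.travel = 1 := (h.travel' rfl).1
    refine ⟨h5.ge, by rw [hT]; norm_num, fun he => ?_⟩
    rcases hS' _ he with h4 | ⟨h4, -⟩
    · cases h4
    · exact (h.travel' rfl).2 h4
  · have hl : e.level < n := (Edge.level_lt (k := m + 1) (by omega) (by omega)).trans hlt
    have h4 := hlow e he hl (by omega) (by omega)
    rcases Edge.eq_of_rank_odd hr with rfl | rfl | rfl <;> exact h4
  · have h4 : c.stays l = true := hlow _ he (show l < n by omega) (by simp [Edge.rank])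
      (show 2 * l + 2 < _ by omega)
    rw [h.leaves l (by omega)] at h4
    cases h4
  · exact hOut.frame.le T' i (hu.trans u) (hmax ▸ v) hi (by omega)
  · rcases (show e.rank = 2 * m + 2 ∨ 2 * m + 3 ≤ e.rank by omega) with h5 | h5
    · rcases Edge.eq_of_rank_even h5 with rfl | rfl
      · simp only [Config.z]
        rw [Config.B_of_leave (by omega) hsm, hAm T' (hu.trans u) (hmax ▸ v),
          hOut.B_eq T' (hu.trans u) (hmax ▸ v)]
        linarith
      · exact (Config.z_of_active hl (by omega) hsm).le
    · exact hOut.frame.stale e he hl h5 T' (hu.trans u) (hmax ▸ v)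
  · rintro c'' S'' ⟨hE', ht, hC⟩
    refine ⟨hE.trans (hE'.mono (by omega)), ht, hC.1, fun i hi => ?_⟩
    rcases (show i + 1 < m + 1 ∨ i = m by omega) with h4 | rfl
    · exact hC.2 i h4
    · rw [hE'.agree.2 i le_rfl]; exact hsm

end Leaving

theorem reset_zero (n : ℕ) : ResetSpec n 0 0 := by
  intro c S D _ _ _ _ ht _ _ _
  exact .done ⟨.refl, ht, by simp, by simp⟩

/-- In a reset of the levels up to `m`, all levels below `m` are boarded, level `m` is skipped, and
the `b`-vertices below `b (m - 1)` return to `stay`. Then the levels below `m` are entered one after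
another, `b m` switches to `leave`, and level `m` is entered. -/
theorem reset_succ {N M : ℕ} (hN : ∀ m', m' + 1 = m → CountSpec n m' N) (hN' : m = 0 → N = 0)
    (hM : StayIncrementSpec n m M) : ResetSpec n (m + 1) (N + M) := by
  intro c S D hm ha hC hs ht hB hF hS
  have hO : Outer n m c S D := ⟨hm, ha, hB, hF⟩
  have hBo : Boarding n m 0 c S D := ⟨hO, ht, by simp, fun i _ hi => hC.1 i (by omega),
    fun i hi => hC.2 i (by omega), hs m rfl, fun e he h1 h2 => .inl (hS e he h1 h2)⟩
  rw [← Nat.zero_add N, Nat.add_assoc]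
  refine (hBo.steps m le_rfl).trans fun c1 S1 ⟨hE1, h1⟩ => ?_
  rw [← Nat.zero_add (N + M)]
  refine h1.skip.trans fun c2 S2 ⟨hE2, h2⟩ => ?_
  rw [← Nat.zero_add (N + M)]
  refine (Staying.steps _ c2 S2 (by omega) h2).trans fun c3 S3 ⟨hE3, h3⟩ => ?_
  refine (h3.toLeaving hN hN').trans fun c4 S4 ⟨hE4, h4⟩ => ?_
  refine (h4.leads hM).imp fun c5 S5 ⟨hE5, h5⟩ => ⟨?_, h5⟩
  exact hE1.trans (hE2.trans (hE3.trans (hE4.trans hE5)))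

/-- Entering level `l` includes a reset of the lower levels and two more switches, and a reset of
the levels below `k` includes entering each of them, so that the number of switches is doubled with
each level. -/
theorem exponential (n k : ℕ) : ResetSpec n k (2 ^ (k + 1) - 2) := by
  induction k using Nat.strong_induction_on with
  | _ k ih =>
  rcases k with - | m
  · exact reset_zero n
  have hinc : ∀ l ≤ m, IncrementSpec n l (2 ^ (l + 1)) := fun l hl => by
    have h1 := increment (ih l (by omega))
    rwa [Nat.sub_add_cancel (by rw [pow_succ]; have := Nat.one_le_two_pow (n := l); omega)] at h1
  have hcount : ∀ l ≤ m, CountSpec n l (2 ^ (l + 2) - 2) := by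
    intro l
    induction l with
    | zero => exact fun _ => count_zero (hinc 0 (by omega))
    | succ l ihl =>
      intro hl
      have h1 := count_succ (ihl (by omega)) (hinc (l + 1) hl)
      have h2 : 2 ^ (l + 2) - 2 + 2 ^ (l + 1 + 1) = 2 ^ (l + 1 + 2) - 2 := by
        have := Nat.one_le_two_pow (n := l)
        simp only [pow_succ]; omega
      rwa [h2] at h1
  have h1 := reset_succ (N := 2 ^ (m + 1) - 2) (m := m)
    (fun m' h => by obtain rfl := h; exact hcount m' (by omega)) (by rintro rfl; rfl)
    (stayIncrement (hinc m le_rfl))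
  have h2 : 2 ^ (m + 1) - 2 + 2 ^ (m + 1) = 2 ^ (m + 1 + 1) - 2 := by
    have := Nat.one_le_two_pow (n := m)
    simp only [pow_succ]; omega
  rwa [h2] at h1

/-! ### The run from the initial policy -/

/-- The policy that skips and leaves all levels. -/
def Config.zero : Config where
  travel := 0
  a _ := .skip
  stays _ := false

theorem Config.zero_values : ∀ m j, j + m = n →
    Config.zero.A n T j = 0 ∧ Config.zero.B n T j = 0 := by
  intro m
  induction m with
  | zero =>
    intro j hj
    obtain rfl : j = n := by omega
    exact ⟨Config.A_last, Config.B_last⟩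
  | succ m ih =>
    intro j hj
    rw [Config.A_of_skip (by omega) rfl, Config.B_of_leave (by omega) rfl]
    exact ⟨(ih (j + 1) (by omega)).1, (ih (j + 1) (by omega)).1⟩

theorem Config.zero_A (hj : j ≤ n) : Config.zero.A n T j = 0 :=
  (Config.zero_values (n - j) j (by omega)).1

theorem Config.zero_B (hj : j ≤ n) : Config.zero.B n T j = 0 :=
  (Config.zero_values (n - j) j (by omega)).2

/-- From the policy that skips and leaves all levels, the levels are entered one after another. -/
theorem leads_climb (hS : ∀ e ∈ S, e.level < n → Config.zero.Active e) (k : ℕ) (hk : k + 1 ≤ n) :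
    Leads n (2 ^ k) .zero S fun c' S' => Ext (2 * (k + 1)) .zero S c' S' ∧ c'.travel = 0 ∧
      (∀ j < k + 1, c'.a j = .enter) ∧ ∀ j < k + 1, c'.stays j = false := by
  induction k with
  | zero =>
    refine .step (T := 0) (e := .enter 0)
      ⟨hk, (Config.zero_A (j := 0) (by omega)).symm, hk, ?_, ?_, ?_, ?_⟩ fun S' hS' =>
        .done ⟨Ext.switch (by simp [Edge.rank]) hS', rfl, fun j hj => ?_, fun _ _ => rfl⟩
    · simp only [Config.z]
      rw [Config.zero_A (by omega), Config.zero_B (by omega)]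
      norm_num
    · intro e he hr
      obtain ⟨i, rfl⟩ := Edge.eq_of_rank_zero (e := e) (by simp only [Edge.rank] at hr ⊢; omega)
      simp only [Config.z]
      rw [Config.zero_A (show i < n from he).le]
      norm_num
    · intro e he hr hne
      rcases Edge.eq_of_rank_odd hr with rfl | rfl | rfl
      · exact absurd rfl hne
      all_goals
        simp only [Config.z]
        simp only [Config.zero_A (show 0 ≤ n by omega), Config.zero_A (show 0 + 1 ≤ n by omega),
          Config.zero_B (show 0 ≤ n by omega)]
        norm_num
    · intro e he hl
      rcases Nat.eq_zero_or_pos e.rank with h1 | h1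
      · obtain ⟨i, rfl⟩ := Edge.eq_of_rank_zero h1
        simp only [Config.z]
        rw [Config.zero_A (show i < n from hl).le]
        norm_num
      · exact (Config.z_of_active hl h1 (hS e he hl)).le
    · obtain rfl : j = 0 := by omega
      simp [Config.switch]
  | succ k ih =>
    rw [pow_succ, mul_two]
    refine (ih (by omega)).trans fun c S' ⟨hE, ht, ha, hs⟩ => ?_
    have hC : Climb (k + 1) c := ⟨ha, fun j hj => hs j (by omega)⟩
    have hA : ∀ T i, i ≤ n → k + 1 ≤ i → c.A n T i = 0 := fun T i hi hi' => by
      rw [hE.agree.A_eq hi (by omega), Config.zero_A hi]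
    have hact : ∀ e ∈ S', e.level < n → 2 * (k + 1) ≤ e.rank → c.Active e := by
      intro e he hl hr
      have h1 := hS e (hE.sub e he hr) hl
      cases e <;> simp only [Edge.rank] at hr <;> simp only [Config.Active] at h1 ⊢
      case travel => omega
      case stay => exact (hE.agree.2 _ hr).trans h1
      case leave => exact (hE.agree.2 _ hr).trans h1
      all_goals exact (hE.agree.1 _ hr).trans h1
    have hT : (2 : ℝ) ^ (k + 2) - 2 = c.A n (2 ^ (k + 2) - 2) c.travel := by
      rw [ht, hC.A_eq (by omega) k 0 (by omega), Config.B_of_leave (by omega) (hs k (by omega)),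
        hA _ _ (by omega) le_rfl]
      norm_num
    have hpow := two_le_two_pow (k + 1)
    have hpow2 : (2 : ℝ) ^ (k + 1 + 2) = 2 * 2 ^ (k + 2) := by ring
    have hspec : StayIncrementSpec n (k + 1) (2 ^ k) := by
      have h1 := stayIncrement (increment (exponential n (k + 1)))
      refine fun c S W T h1' h2 h3 h4 h5 h6 h7 h8 h9 h10 h11 h12 h13 h14 =>
        .weaken ?_ (h1 c S W T h1' h2 h3 h4 h5 h6 h7 h8 h9 h10 h11 h12 h13 h14)
      have := Nat.one_le_two_pow (n := k)
      simp only [pow_succ]; omega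
    refine (hspec c S' 0 (2 ^ (k + 2) - 2) hk (by omega) hT (by linarith)
      ((hE.agree.1 _ (by omega)).trans rfl) ((hE.agree.2 _ (by omega)).trans rfl)
      (fun T' _ _ => hA T' _ hk (by omega)) ha hs (fun _ => ht) (fun h => by omega)
      (fun e he hr => hact e he ((Edge.level_lt (k := k + 2) (by omega) (by omega)).trans_le hk)
        (by omega)) (fun l hl he => ?_)
      ⟨fun T' i u _ hi hi' => ?_, fun e he hl hr T' _ _ => ?_⟩).imp ?_
    · have h1 := hS _ (hE.sub _ he (by simp only [Edge.rank]; omega)) (show l < n by omega)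
      cases h1
    · rw [hA T' i hi (by omega)]; linarith
    · exact (Config.z_of_active hl (by omega) (hact e he hl (by omega))).le
    · rintro c' S'' ⟨hE', ht', hC'⟩
      refine ⟨(hE.mono (by omega)).trans hE', ht', hC'.1, fun j hj => ?_⟩
      rcases (show j + 1 < k + 1 + 1 ∨ j = k + 1 by omega) with h1 | rfl
      · exact hC'.2 j h1
      · rw [hE'.agree.2 _ (by omega), hE.agree.2 _ (by omega)]; rfl

end BinaryCounter

/-! ### Lower bounds for the number of switches -/

namespace MDP

variable {A R : Type*} [Fintype A] [Fintype R] [DecidableEq A]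

/-- Every run of policy iteration from `π`, with an arbitrary choice of one of the three rules in
each step, makes at least `M` improving switches. -/
def MinSwitches (G : MDP A R) (N : A × (A ⊕ R) → ℕ) (π : A → A ⊕ R) (M : ℕ) : Prop :=
  ∀ X : ℕ → A → A ⊕ R, G.IsCombinedRun N π X → ∀ k, (∀ e, ¬ G.IsImproving (X k) e) → M ≤ k

variable {G : MDP A R} {N : A × (A ⊕ R) → ℕ} {π : A → A ⊕ R} {M M' : ℕ}

theorem MinSwitches.mono (h : G.MinSwitches N π M) (hM : M' ≤ M) : G.MinSwitches N π M' :=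
  fun X hX k hk => hM.trans (h X hX k hk)

theorem MinSwitches.step (hex : ∃ e, G.IsImproving π e)
    (h : ∀ r e, G.Chooses N r π e → G.MinSwitches N (applySwitch π e) M) :
    G.MinSwitches N π (M + 1) := by
  rintro X ⟨h0, hX⟩ k hk
  obtain ⟨e₀, he₀⟩ := hex
  cases k with
  | zero => exact absurd (h0 ▸ he₀) (hk e₀)
  | succ k =>
    rcases hX 0 with ⟨r, e, hc, h1⟩ | ⟨hno, -⟩
    · rw [h0] at hc h1
      exact Nat.succ_le_succ (h r e hc (fun k => X (k + 1)) ⟨h1, fun k => hX (k + 1)⟩ k hk)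
    · exact absurd (h0 ▸ he₀) (hno e₀)

theorem MinSwitches.le_numSwitches (h : G.MinSwitches N π M) {X : ℕ → A → A ⊕ R}
    (hX : G.IsCombinedRun N π X) : (M : ℕ∞) ≤ G.numSwitches X :=
  le_iInf₂ fun k hk => by exact_mod_cast h X hX k hk

theorem Chooses.isImproving {r : PivotRule} {e : A × (A ⊕ R)} (h : G.Chooses N r π e) :
    G.IsImproving π e := by
  cases r <;> exact h.1

end MDP

namespace BVertex

variable {n : ℕ} {v w : BVertex n}

theorem one_le_number (v : BVertex n) : 1 ≤ v.number := by cases v <;> simp only [number] <;> omega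

theorem number_injective : Function.Injective (number : BVertex n → ℕ) := by
  intro v w h
  cases v <;> cases w <;> simp only [number] at h <;>
    first | rfl | omega | (congr 1; omega)

theorem p_le_mul (h : v.number < w.number) : w.p ≤ v.p * (1 / 2) ^ (n + 5) := by
  unfold p
  rw [← pow_add]
  refine pow_le_pow_of_le_one (by norm_num) (by norm_num) ?_
  calc v.number * (n + 5) + (n + 5) = (v.number + 1) * (n + 5) := by ring
    _ ≤ _ := Nat.mul_le_mul_right _ h

theorem p_le (v : BVertex n) : v.p ≤ (1 / 2) ^ (n + 5) :=
  pow_le_pow_of_le_one (by norm_num) (by norm_num) (Nat.le_mul_of_pos_left _ v.one_le_number)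

end BVertex

/-- The Bland numbering of the edges is compatible with the order of their start vertices. -/
theorem BEdge.number_lt {n : ℕ} {e e' : BEdge n} (h : e.src.number < e'.src.number) :
    e.number < e'.number := by
  cases e <;> cases e' <;> simp only [src, BVertex.number, number] at h ⊢ <;> omega

namespace TwinProcess

open BinaryCounter

/-! ### The visited policies of `D n` -/

section Values

variable {n : ℕ}

/-- The reduced costs of an edge of `B n` with respect to a value function. -/
noncomputable def cost (f : BVertex n → ℝ) (e : BEdge n) : ℝ := e.reward + f e.tgt - f e.src

/-- The policies of `D n` that are visited: in the vertex `v` of `B n`, the edge `σ v` of `B n` is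
chosen, and `S` is the set of the prepared edges `e`, for which `x e → y e` is active. -/
def policy (σ : BVertex n → BEdge n) (S : Finset (BEdge n)) : DAgent n → DVertex n
  | .base v => if v = .s then .inl (.base .s) else .inl (.x (σ v))
  | .x e => if e ∈ S then .inr e else .inl (.base e.src)
  | .z e => .inl (.base e.tgt)

/-- A policy `σ` of `B n` that leads to the sink from everywhere, with value function `f`, together
with a set `S` of prepared edges. That values are non-negative multiples of `1 / 4` is preserved by
improving switches. -/
structure Good (σ : BVertex n → BEdge n) (S : Finset (BEdge n)) (f : BVertex n → ℝ) : Prop where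
  src : ∀ v, v ≠ .s → (σ v).src = v
  mem : ∀ v, v ≠ .s → σ v ∈ S
  wf : WellFounded fun w v => v ≠ .s ∧ w = (σ v).tgt
  value_s : f .s = 0
  value : ∀ v, v ≠ .s → f v = (σ v).reward + f (σ v).tgt
  nonneg : ∀ v, 0 ≤ f v
  quarter : ∀ v, ∃ m : ℤ, f v = m / 4

/-- A potential function such that no edge has a reward greater than the difference of the
potentials. -/
noncomputable def potential : BVertex n → ℝ
  | .t => 2
  | .a i => 2 ^ (i.val + 1)
  | .b i => 2 ^ (i.val + 2)
  | .d => 2 ^ (n + 2)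
  | .s => 2 ^ (n + 2)

theorem le_potential_nextA (i : Fin n) : 2 ^ (i.val + 2) ≤ potential (BVertex.nextA i) := by
  unfold BVertex.nextA
  split_ifs
  · simp [potential]
  · exact two_pow_le_two_pow (by omega)

theorem le_potential_nextB (i : Fin n) : 2 ^ (i.val + 3) ≤ potential (BVertex.nextB i) := by
  unfold BVertex.nextB
  split_ifs
  · simp [potential]
  · exact two_pow_le_two_pow (by omega)

/-- The potential bounds the values of all policies without cycles, and it excludes that an
improving switch closes a cycle. -/
theorem reward_le (e : BEdge n) : e.reward ≤ potential e.tgt - potential e.src := by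
  have h2 (i : ℕ) : (2 : ℝ) ^ (i + 2) = 2 * 2 ^ (i + 1) := by ring
  have h3 (i : ℕ) : (2 : ℝ) ^ (i + 3) = 4 * 2 ^ (i + 1) := by ring
  cases e with
  | dummy => simp [BEdge.reward, BEdge.tgt, BEdge.src, potential]
  | _ i =>
    have h1 := two_le_two_pow i.val
    have h4 := le_potential_nextA i
    have h5 := le_potential_nextB i
    have h6 := h2 i
    have h7 := h3 i
    have h8 : potential (.a i) = 2 ^ (i.val + 1) := rfl
    have h9 : potential (.b i) = 2 ^ (i.val + 2) := rfl
    have h10 : potential (.t : BVertex n) = 2 := rfl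
    simp only [BEdge.reward, BEdge.tgt, BEdge.src]
    linarith

theorem potential_nonneg (v : BVertex n) : 0 ≤ potential v := by
  cases v <;> simp only [potential] <;> positivity

theorem src_ne_s (e : BEdge n) : e.src ≠ .s := by cases e <;> simp [BEdge.src]

theorem abs_reward_le (e : BEdge n) : |e.reward| ≤ 2 ^ n := by
  cases e with
  | dummy => simp [BEdge.reward]
  | _ i =>
    have h1 := two_le_two_pow i.val
    have h2 : (2 : ℝ) ^ (i.val + 1) ≤ 2 ^ n := two_pow_le_two_pow i.2
    simp only [BEdge.reward]
    rw [abs_le]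
    constructor <;> linarith

theorem reward_quarter (e : BEdge n) : ∃ m : ℤ, e.reward = m / 4 := by
  cases e with
  | travel | skip | leave | dummy => exact ⟨0, by simp [BEdge.reward]⟩
  | enter i => exact ⟨4 * 2 ^ (i.val + 1), by simp [BEdge.reward]⟩
  | board i => exact ⟨-4 * 2 ^ (i.val + 1) + 5, by simp [BEdge.reward]; ring⟩
  | stay i => exact ⟨3, by simp [BEdge.reward]; norm_num⟩

variable {σ : BVertex n → BEdge n} {S S' : Finset (BEdge n)} {f g : BVertex n → ℝ} {e : BEdge n}

namespace Good

theorem value_le (h : Good σ S f) (v : BVertex n) : f v + potential v ≤ 2 ^ (n + 2) := by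
  induction v using h.wf.induction with
  | _ v ih =>
  by_cases hv : v = .s
  · subst hv; rw [h.value_s]; simp [potential]
  · have h1 := ih _ ⟨hv, rfl⟩
    have h2 := reward_le (σ v)
    rw [h.src v hv] at h2
    rw [h.value v hv]
    linarith

theorem cost_eq_zero (h : Good σ S f) {v : BVertex n} (hv : v ≠ .s) : cost f (σ v) = 0 := by
  rw [cost, h.src v hv, h.value v hv]; ring

theorem abs_cost_lt (h : Good σ S f) (e : BEdge n) : |cost f e| < 2 ^ (n + 3) := by
  have h1 := abs_le.1 (abs_reward_le e)
  have h2 := h.value_le e.tgt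
  have h3 := h.value_le e.src
  have h4 := h.nonneg e.tgt
  have h5 := h.nonneg e.src
  have h6 := potential_nonneg e.tgt
  have h7 := potential_nonneg e.src
  have h8 : (2 : ℝ) ^ (n + 2) = 4 * 2 ^ n := by ring
  have h9 : (2 : ℝ) ^ (n + 3) = 8 * 2 ^ n := by ring
  have h10 : (0 : ℝ) < 2 ^ n := by positivity
  rw [cost, abs_lt]
  constructor <;> linarith

theorem quarter_le_abs_cost (h : Good σ S f) (he : cost f e ≠ 0) : 1 / 4 ≤ |cost f e| := by
  obtain ⟨a, ha⟩ := reward_quarter e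
  obtain ⟨b, hb⟩ := h.quarter e.tgt
  obtain ⟨c, hc⟩ := h.quarter e.src
  have h1 : cost f e = ((a + b - c : ℤ) : ℝ) / 4 := by rw [cost, ha, hb, hc]; push_cast; ring
  have h2 : a + b - c ≠ 0 := by rintro h0; rw [h1, h0] at he; simp at he
  have h3 : (1 : ℝ) ≤ |((a + b - c : ℤ) : ℝ)| := by
    rw [← Int.cast_abs]; exact_mod_cast Int.one_le_abs h2
  rw [h1, abs_div, abs_of_pos (show (0 : ℝ) < 4 by norm_num)]
  linarith

theorem insert (h : Good σ S f) (e : BEdge n) : Good σ (insert e S) f :=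
  { h with mem := fun v hv => Finset.mem_insert_of_mem (h.mem v hv) }

theorem erase (h : Good σ S f) (he : cost f e < 0) : Good σ (S.erase e) f :=
  { h with
    mem := fun v hv =>
      Finset.mem_erase.2 ⟨by rintro rfl; exact he.ne (h.cost_eq_zero hv), h.mem v hv⟩ }

/-- An improving switch does not create cycles, as the sum of the value and the potential does not
decrease along the edges of the old policy and increases along the new edge. -/
theorem switch (h : Good σ S f) (he : e ∈ S) (hc : 0 < cost f e) :
    ∃ f', Good (Function.update σ e.src e) S f' ∧ (∀ v, f v ≤ f' v) ∧
      f e.src + cost f e ≤ f' e.src := by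
  set σ' := Function.update σ e.src e with hσ'
  have hup : ∀ v, v ≠ e.src → σ' v = σ v := fun v hv => Function.update_of_ne hv _ _
  have hup' : σ' e.src = e := Function.update_self _ _ _
  have hsrc : ∀ v, v ≠ .s → (σ' v).src = v := by
    intro v hv
    by_cases hve : v = e.src
    · rw [hve, hup']
    · rw [hup v hve, h.src v hv]
  have hwf : WellFounded fun w v => v ≠ .s ∧ w = (σ' v).tgt := by
    have hgt : WellFounded fun u v : BVertex n => f v + potential v < f u + potential u :=
      haveI : IsTrans (BVertex n) fun u v => f v + potential v < f u + potential u :=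
        ⟨fun _ _ _ a b => lt_trans b a⟩
      haveI : Std.Irrefl fun u v : BVertex n => f v + potential v < f u + potential u :=
        ⟨fun _ => lt_irrefl _⟩
      Finite.wellFounded_of_trans_of_irrefl _
    refine ⟨fun v => ?_⟩
    induction v using hgt.induction with
    | _ v ih =>
    induction v using h.wf.induction with
    | _ v ih' =>
    refine ⟨_, ?_⟩
    rintro w ⟨hv, rfl⟩
    by_cases hve : v = e.src
    · refine ih _ ?_
      rw [hve, hup']
      have := reward_le e
      rw [cost] at hc
      linarith
    · rw [hup v hve]
      refine ih' _ ⟨hv, rfl⟩ fun u hu => ih u ?_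
      have h1 := reward_le (σ v)
      rw [h.src v hv] at h1
      rw [h.value v hv]
      linarith
  let f' : BVertex n → ℝ := hwf.fix fun v F =>
    if hv : v = .s then 0 else (σ' v).reward + F (σ' v).tgt ⟨hv, rfl⟩
  have hs' : f' .s = 0 := by
    simp only [f']; rw [WellFounded.fix_eq]; simp
  have hv' : ∀ v, v ≠ .s → f' v = (σ' v).reward + f' (σ' v).tgt := by
    intro v hv
    simp only [f']; rw [WellFounded.fix_eq]; simp [hv]
  have hle : ∀ v, f v ≤ f' v := by
    intro v
    induction v using hwf.induction with
    | _ v ih =>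
    by_cases hv : v = .s
    · rw [hv, h.value_s, hs']
    · have h1 := ih _ ⟨hv, rfl⟩
      rw [hv' v hv]
      by_cases hve : v = e.src
      · rw [hve, hup'] at h1 ⊢
        rw [cost] at hc
        linarith
      · rw [hup v hve] at h1 ⊢
        rw [h.value v hv]
        linarith
  refine ⟨f', ⟨hsrc, fun v hv => ?_, hwf, hs', hv', fun v => (h.nonneg v).trans (hle v),
    fun v => ?_⟩, hle, ?_⟩
  · by_cases hve : v = e.src
    · rw [hve, hup']; exact he
    · rw [hup v hve]; exact h.mem v hv
  · induction v using hwf.induction with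
    | _ v ih =>
    by_cases hv : v = .s
    · exact ⟨0, by rw [hv, hs']; simp⟩
    · obtain ⟨a, ha⟩ := ih _ ⟨hv, rfl⟩
      obtain ⟨b, hb⟩ := reward_quarter (σ' v)
      exact ⟨b + a, by rw [hv' v hv, ha, hb]; push_cast; ring⟩
  · rw [hv' _ (src_ne_s e), hup', cost]
    linarith [hle e.tgt]

end Good

/-! ### Values in `D n` -/

theorem sum_dProb_mul (e : BEdge n) (F : DVertex n → ℝ) :
    ∑ w, dProb n (e, w) * F w =
      (1 - e.src.p) * F (.inl (.base e.src)) + e.src.p * F (.inl (.z e)) := by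
  simp only [dProb, add_mul, ite_mul, zero_mul]
  rw [Finset.sum_add_distrib, Finset.sum_ite_eq' Finset.univ, Finset.sum_ite_eq' Finset.univ]
  simp

theorem policy_base {v : BVertex n} (hv : v ≠ .s) : policy σ S (.base v) = .inl (.x (σ v)) := by
  simp [policy, hv]

/-- A function that is harmonic for a good policy and vanishes at the sink is zero. -/
theorem Good.harmonic_eq_zero (h : Good σ S f) {F : DVertex n → ℝ} (hs : F (.inl (.base .s)) = 0)
    (hA : ∀ u, F (.inl u) = F (policy σ S u)) (hR : ∀ e, F (.inr e) = ∑ w, dProb n (e, w) * F w)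
    (v : DVertex n) : F v = 0 := by
  have hz : ∀ e, F (.inl (.z e)) = F (.inl (.base e.tgt)) := fun e => hA (.z e)
  have hbase : ∀ v, F (.inl (.base v)) = 0 := by
    intro v
    induction v using h.wf.induction with
    | _ v ih =>
    by_cases hv : v = .s
    · rw [hv, hs]
    · have h1 := hA (.base v)
      have h2 := hA (.x (σ v))
      have h3 := hR (σ v)
      rw [policy_base hv] at h1
      rw [policy, if_pos (h.mem v hv)] at h2
      rw [sum_dProb_mul, h.src v hv, hz, ih _ ⟨hv, rfl⟩, ← h2, ← h1] at h3
      have h4 : v.p * F (.inl (.base v)) = 0 := by linarith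
      exact (mul_eq_zero.1 h4).resolve_left v.p_pos.ne'
  have hy : ∀ e, F (.inr e) = 0 := fun e => by
    rw [hR, sum_dProb_mul, hz, hbase, hbase]; simp
  rcases v with (v | e | e) | e
  · exact hbase v
  · rw [hA, policy]
    split_ifs
    · exact hy e
    · exact hbase _
  · rw [hz, hbase]
  · exact hy e

variable [NeZero n]

/-- The value function of a good policy of `D n`. -/
noncomputable def dValue (S : Finset (BEdge n)) (f : BVertex n → ℝ) : DVertex n → ℝ
  | .inl (.base v) => f v
  | .inl (.x e) => f e.src + if e ∈ S then e.src.p * cost f e else 0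
  | .inl (.z e) => e.reward + f e.tgt
  | .inr e => f e.src + e.src.p * cost f e

theorem Good.reachable (h : Good σ S f) (v : DVertex n) :
    Relation.ReflTransGen (dMDP n).Adj v (.inl (.base .s)) := by
  have hz : ∀ e, (dMDP n).Adj (.inl (.z e)) (.inl (.base e.tgt)) := fun e => DAgentEdge.zw e
  have hy : ∀ e, (dMDP n).Adj (.inr e) (.inl (.z e)) := fun e => DRandEdge.yz e
  have hx : ∀ e, (dMDP n).Adj (.inl (.x e)) (.inr e) := fun e => DAgentEdge.xy e
  have hbase : ∀ v, Relation.ReflTransGen (dMDP n).Adj (.inl (.base v)) (.inl (.base .s)) := by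
    intro v
    induction v using h.wf.induction with
    | _ v ih =>
    by_cases hv : v = .s
    · rw [hv]
    · have h1 : (dMDP n).Adj (.inl (.base v)) (.inl (.x (σ v))) := by
        have := DAgentEdge.vx (σ v)
        rwa [h.src v hv] at this
      exact .head h1 (.head (hx _) (.head (hy _) (.head (hz _) (ih _ ⟨hv, rfl⟩))))
  rcases v with (v | e | e) | e
  · exact hbase v
  · exact .head (hx _) (.head (hy _) (.head (hz _) (hbase _)))
  · exact .head (hz _) (hbase _)
  · exact .head (hy _) (.head (hz _) (hbase _))

theorem Good.isSink_iff (h : Good σ S f) (u : DAgent n) : (dMDP n).IsSink u ↔ u = .base .s := by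
  constructor
  · rintro ⟨hu, -, -⟩
    rcases u with v | e | e
    · by_contra hv
      have hv : v ≠ .s := fun h => hv (by rw [h])
      have h1 := DAgentEdge.vx (σ v)
      rw [h.src v hv] at h1
      simpa using (hu _).1 h1
    · simpa using (hu _).1 (DAgentEdge.xy e)
    · simpa using (hu _).1 (DAgentEdge.zw e)
  · rintro rfl
    refine ⟨fun w => ⟨fun hw => ?_, ?_⟩, rfl, h.reachable⟩
    · have key : ∀ q : DAgent n × DVertex n, DAgentEdge n q → q.1 = .base .s →
          q.2 = .inl (.base .s) := by
        rintro q (e | e | e | e | _) hq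
        · exact absurd (by simpa using hq) (src_ne_s e)
        all_goals simp_all
      exact key _ hw rfl
    · rintro rfl; exact DAgentEdge.loop

theorem Good.isPolicy (h : Good σ S f) : (dMDP n).IsPolicy (policy σ S) := by
  rintro (v | e | e)
  · by_cases hv : v = .s
    · subst hv; exact DAgentEdge.loop
    · rw [policy_base hv]
      have h1 := DAgentEdge.vx (σ v)
      rwa [h.src v hv] at h1
  · rw [policy]
    split_ifs
    · exact DAgentEdge.xy e
    · exact DAgentEdge.xv e
  · exact DAgentEdge.zw e

theorem Good.isValue (h : Good σ S f) : (dMDP n).IsValue (policy σ S) (dValue S f) := by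
  refine ⟨?_, fun e => ?_, fun s hs => ?_⟩
  · rintro (v | e | e)
    · by_cases hv : v = .s
      · subst hv; simp [policy, dValue, dMDP, dReward]
      · rw [policy_base hv]
        simp [dValue, dMDP, dReward, h.src v hv, h.cost_eq_zero hv]
    · by_cases he : e ∈ S <;> simp [policy, he, dValue, dMDP, dReward]
    · simp [policy, dValue, dMDP, dReward]
  · change _ = ∑ w, dProb n (e, w) * _
    rw [sum_dProb_mul]
    simp only [dValue, cost]
    ring
  · rw [(h.isSink_iff s).1 hs]
    exact h.value_s

theorem Good.value_eq (h : Good σ S f) : (dMDP n).value (policy σ S) = dValue S f := by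
  have hex : ∃ F, (dMDP n).IsValue (policy σ S) F := ⟨_, h.isValue⟩
  rw [MDP.value, dif_pos hex]
  obtain ⟨h1, h2, h3⟩ := hex.choose_spec
  obtain ⟨h1', h2', h3'⟩ := h.isValue
  have hsink := (h.isSink_iff (.base .s)).2 rfl
  funext v
  have := h.harmonic_eq_zero (F := fun v => hex.choose v - dValue S f v)
    (by simp only [h3 _ hsink, h3' _ hsink, sub_zero])
    (fun u => by simp only [h1 u, h1' u]; ring)
    (fun e => by
      simp only [h2 e, h2' e, mul_sub, Finset.sum_sub_distrib]
      rfl) v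
  simpa [sub_eq_zero] using this

theorem hitProb_mem_Icc (π : DAgent n → DVertex n) (k : ℕ) (v : DVertex n) :
    (dMDP n).hitProb π (.base .s) k v ∈ Set.Icc 0 1 := by
  induction k generalizing v with
  | zero => rw [MDP.hitProb]; split_ifs <;> simp
  | succ k ih =>
    rcases v with u | e <;> simp only [MDP.hitProb]
    · split_ifs
      · simp
      · exact ih _
    · rw [if_neg (by simp)]
      · refine ⟨Finset.sum_nonneg fun w _ => mul_nonneg ((dMDP n).prob_nonneg _) (ih w).1, ?_⟩
        rw [← (dMDP n).prob_sum e]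
        exact Finset.sum_le_sum fun w _ =>
          mul_le_of_le_one_right ((dMDP n).prob_nonneg _) (ih w).2

theorem hitProb_le_succ (π : DAgent n → DVertex n) (k : ℕ) (v : DVertex n) :
    (dMDP n).hitProb π (.base .s) k v ≤ (dMDP n).hitProb π (.base .s) (k + 1) v := by
  induction k generalizing v with
  | zero =>
    by_cases hv : v = .inl (.base .s)
    · simp [MDP.hitProb, hv]
    · have h0 : (dMDP n).hitProb π (.base .s) 0 v = 0 := by simp [MDP.hitProb, hv]
      rw [h0]
      exact (hitProb_mem_Icc π 1 v).1
  | succ k ih =>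
    by_cases hv : v = .inl (.base .s)
    · simp [MDP.hitProb, hv]
    · rcases v with u | e <;> rw [MDP.hitProb, MDP.hitProb, if_neg hv, if_neg hv]
      · exact ih _
      · exact Finset.sum_le_sum fun w _ =>
          mul_le_mul_of_nonneg_left (ih w) ((dMDP n).prob_nonneg _)

theorem Good.isWeakUnichain (h : Good σ S f) : (dMDP n).IsWeakUnichain (policy σ S) := by
  refine ⟨h.isPolicy, .base .s, (h.isSink_iff _).2 rfl, ?_⟩
  set q := (dMDP n).hitProb (policy σ S) (.base .s) with hq
  have hlim : ∀ v, ∃ l, Filter.Tendsto (fun k => q k v) Filter.atTop (𝓝 l) := fun v =>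
    ⟨_, tendsto_atTop_ciSup
      (monotone_nat_of_le_succ fun k => hitProb_le_succ (policy σ S) k v)
      ⟨1, by rintro _ ⟨k, rfl⟩; exact (hitProb_mem_Icc (policy σ S) k v).2⟩⟩
  choose L hL using hlim
  have hs : ∀ k, q k (.inl (.base .s)) = 1 := by
    intro k; cases k <;> simp [hq, MDP.hitProb]
  have hLs : L (.inl (.base .s)) = 1 := by
    refine tendsto_nhds_unique (hL _) ?_
    simp only [hs]
    exact tendsto_const_nhds
  have hLA : ∀ u, L (.inl u) = L (policy σ S u) := by
    intro u
    by_cases hu : u = .base .s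
    · subst hu; simp [policy]
    · refine tendsto_nhds_unique ((hL (.inl u)).comp (Filter.tendsto_add_atTop_nat 1)) ?_
      refine (hL (policy σ S u)).congr fun k => ?_
      simp [hq, MDP.hitProb, hu]
  have hLR : ∀ e, L (.inr e) = ∑ w, dProb n (e, w) * L w := by
    intro e
    refine tendsto_nhds_unique ((hL (.inr e)).comp (Filter.tendsto_add_atTop_nat 1)) ?_
    refine (tendsto_finsetSum _ fun w _ => (hL w).const_mul (dProb n (e, w))).congr fun k => ?_
    simp [hq, MDP.hitProb, dMDP]
  intro v
  have h1 := h.harmonic_eq_zero (F := fun v => L v - 1) (by simp [hLs])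
    (fun u => by simp [hLA u]) (fun e => by
      have h2 := (dMDP n).prob_sum e
      change ∑ w, dProb n (e, w) = 1 at h2
      simp only [hLR e, mul_sub, Finset.sum_sub_distrib, mul_one, h2]) v
  have h2 : L v = 1 := by simpa [sub_eq_zero] using h1
  rw [← h2]
  exact hL v

end Values

section Rules

variable {n : ℕ} {σ : BVertex n → BEdge n} {S S' : Finset (BEdge n)}
  {f f' : BVertex n → ℝ} {e e' : BEdge n} {N : DAgent n × DVertex n → ℕ} {r : MDP.PivotRule}
  {q : DAgent n × DVertex n} {M : ℕ}

/-! ### Improving switches in `D n` -/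

/-- The switch in `x e` that removes `e` from the set of prepared edges or adds it to this set. -/
def toggle (S : Finset (BEdge n)) (e : BEdge n) : DAgent n × DVertex n :=
  (.x e, if e ∈ S then .inl (.base e.src) else .inr e)

/-- The switch that activates a prepared edge. -/
def activate (e : BEdge n) : DAgent n × DVertex n := (.base e.src, .inl (.x e))

/-- The sum of the values of all agent vertices. -/
noncomputable def total (S : Finset (BEdge n)) (f : BVertex n → ℝ) : ℝ :=
  ∑ v : DAgent n, dValue S f (.inl v)

theorem applySwitch_toggle :
    MDP.applySwitch (policy σ S) (toggle S e) =
      policy σ (if e ∈ S then S.erase e else insert e S) := by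
  funext u
  rw [MDP.applySwitch]
  rcases u with v | g | g
  · rw [Function.update_of_ne (by simp [toggle])]; rfl
  · by_cases hg : g = e
    · subst hg
      by_cases he : g ∈ S <;> simp [toggle, policy, he]
    · rw [Function.update_of_ne (by simpa [toggle] using hg)]
      by_cases he : e ∈ S <;> simp [policy, he, hg]
  · rw [Function.update_of_ne (by simp [toggle])]; rfl

theorem applySwitch_activate :
    MDP.applySwitch (policy σ S) (activate e) = policy (Function.update σ e.src e) S := by
  funext u
  rw [MDP.applySwitch]
  rcases u with v | g | g
  · by_cases hv : v = e.src
    · subst hv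
      simp [activate, policy, src_ne_s]
    · rw [Function.update_of_ne (by simpa [activate] using hv)]
      simp [policy, Function.update_of_ne hv]
  · rw [Function.update_of_ne (by simp [activate])]; rfl
  · rw [Function.update_of_ne (by simp [activate])]; rfl

/-- The prepared edges only matter for the values of the vertices `x e`. -/
theorem total_sub {S₁ S₂ : Finset (BEdge n)} (h : ∀ g, g ≠ e → (g ∈ S₁ ↔ g ∈ S₂)) :
    total S₁ f - total S₂ f = dValue S₁ f (.inl (.x e)) - dValue S₂ f (.inl (.x e)) := by
  rw [total, total, ← Finset.sum_sub_distrib]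
  refine Finset.sum_eq_single (DAgent.x e) (fun u _ hu => ?_)
    (fun h => absurd (Finset.mem_univ _) h)
  rcases u with v | g | g
  · simp [dValue]
  · have := h g (by simpa using hu)
    simp [dValue, this]
  · simp [dValue]

theorem total_toggle : total (if e ∈ S then S.erase e else insert e S) f =
    total S f + e.src.p * if e ∈ S then -cost f e else cost f e := by
  have h := total_sub (f := f) (S₁ := if e ∈ S then S.erase e else insert e S) (S₂ := S) (e := e)
    (fun g hg => by split_ifs <;> simp [hg])
  by_cases he : e ∈ S <;> simp [he, dValue] at h ⊢ <;> linarith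

/-- A switch in a vertex of `B n` increases the sum of values by at least the reduced costs of the
edge of `B n`, which have not been scaled by a small probability. -/
theorem total_le (h : ∀ v, f v ≤ f' v) (he : f e.src + cost f e ≤ f' e.src) :
    total S f + cost f e ≤ total S f' := by
  have hle : ∀ v, dValue S f (.inl v) ≤ dValue S f' (.inl v) := by
    rintro (v | g | g)
    · exact h v
    · simp only [dValue]
      split_ifs
      · have h0 := g.src.p_pos
        have h1 := g.src.p_le_one
        have h2 := mul_le_mul_of_nonneg_left (h g.src) (sub_nonneg.2 h1)
        have h3 := mul_le_mul_of_nonneg_left (h g.tgt) h0.le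
        simp only [cost]
        linarith
      · simpa using h g.src
    · simpa [dValue] using h g.tgt
  have h1 := Finset.single_le_sum (f := fun v => dValue S f' (.inl v) - dValue S f (.inl v))
    (fun v _ => sub_nonneg.2 (hle v)) (Finset.mem_univ (DAgent.base e.src))
  rw [Finset.sum_sub_distrib] at h1
  simp only [dValue] at h1
  simp only [total, dValue]
  linarith

namespace Good

theorem toggled (h : Good σ S f) (he : 0 < if e ∈ S then -cost f e else cost f e) :
    Good σ (if e ∈ S then S.erase e else Insert.insert e S) f := by
  split_ifs at he ⊢
  · exact h.erase (by linarith)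
  · exact h.insert e

theorem abs_cost_mul_lt (h : Good σ S f) (e : BEdge n) : e.src.p * |cost f e| < 1 / 4 := by
  have h1 := h.abs_cost_lt e
  calc e.src.p * |cost f e| ≤ (1 / 2) ^ (n + 5) * |cost f e| :=
        mul_le_mul_of_nonneg_right e.src.p_le (abs_nonneg _)
    _ < (1 / 2) ^ (n + 5) * 2 ^ (n + 3) := mul_lt_mul_of_pos_left h1 (by positivity)
    _ = 1 / 4 := by
        rw [one_div, inv_pow, show n + 5 = n + 3 + 2 from rfl, pow_add]
        field_simp
        norm_num

/-- The probabilities are so small that reduced costs in an earlier vertex always dominate. -/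
theorem abs_cost_mul_lt_mul (h : Good σ S f) (he : e.src.number < e'.src.number)
    (h0 : cost f e ≠ 0) : e'.src.p * |cost f e'| < e.src.p * |cost f e| := by
  have h1 := h.abs_cost_lt e'
  have h2 := h.quarter_le_abs_cost h0
  have h3 := e.src.p_pos
  calc e'.src.p * |cost f e'| ≤ e.src.p * (1 / 2) ^ (n + 5) * |cost f e'| :=
        mul_le_mul_of_nonneg_right (BVertex.p_le_mul he) (abs_nonneg _)
    _ < e.src.p * (1 / 2) ^ (n + 5) * 2 ^ (n + 3) := mul_lt_mul_of_pos_left h1 (by positivity)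
    _ = e.src.p * (1 / 4) := by
        rw [one_div, inv_pow, show n + 5 = n + 3 + 2 from rfl, pow_add]
        field_simp
        norm_num
    _ ≤ _ := mul_le_mul_of_nonneg_left h2 h3.le

end Good

/-- The edge `e` of `B n` is improving and starts in the first vertex with improving edges, where it
has the largest reduced costs and the smallest number. -/
structure Preferred (f : BVertex n → ℝ) (e : BEdge n) : Prop where
  pos : 0 < cost f e
  lower : ∀ e' : BEdge n, e'.src.number < e.src.number → cost f e' ≤ 0
  same : ∀ e' : BEdge n, e'.src = e.src → e' ≠ e →
    cost f e' < cost f e ∧ (0 < cost f e' → e.number < e'.number)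

theorem Preferred.number_lt (h : Preferred f e) (he' : e' ≠ e) (hpos : 0 < cost f e') :
    e.number < e'.number := by
  rcases lt_trichotomy e'.src.number e.src.number with hlt | heq | hgt
  · exact absurd hpos (h.lower _ hlt).not_gt
  · exact (h.same e' (BVertex.number_injective heq) he').2 hpos
  · exact BEdge.number_lt hgt

theorem Preferred.mul_lt (h : Preferred f e) (hg : Good σ S f) (he' : e' ≠ e)
    (hpos : 0 < cost f e') : e'.src.p * cost f e' < e.src.p * cost f e := by
  rcases lt_trichotomy e'.src.number e.src.number with hlt | heq | hgt
  · exact absurd hpos (h.lower _ hlt).not_gt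
  · have hs := BVertex.number_injective heq
    rw [hs]
    exact mul_lt_mul_of_pos_left (h.same e' hs he').1 e.src.p_pos
  · have := hg.abs_cost_mul_lt_mul hgt h.pos.ne'
    rwa [abs_of_pos hpos, abs_of_pos h.pos] at this

variable [NeZero n]

namespace Good

theorem reducedCost_eq (h : Good σ S f) (q : DAgent n × DVertex n) :
    (dMDP n).reducedCost (policy σ S) q = dReward n q + dValue S f q.2 - dValue S f (.inl q.1) := by
  rw [MDP.reducedCost, h.value_eq]; rfl

theorem reducedCost_toggle (h : Good σ S f) : (dMDP n).reducedCost (policy σ S) (toggle S e) =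
    e.src.p * if e ∈ S then -cost f e else cost f e := by
  rw [h.reducedCost_eq]
  by_cases he : e ∈ S <;> simp [toggle, dReward, dValue, he]

theorem reducedCost_activate (h : Good σ S f) (he : e ∈ S) :
    (dMDP n).reducedCost (policy σ S) (activate e) = e.src.p * cost f e := by
  rw [h.reducedCost_eq]
  simp [activate, dReward, dValue, he]

theorem isImproving_toggle (h : Good σ S f) : (dMDP n).IsImproving (policy σ S) (toggle S e) ↔
    0 < if e ∈ S then -cost f e else cost f e := by
  rw [MDP.IsImproving, h.reducedCost_toggle, mul_pos_iff_of_pos_left e.src.p_pos]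
  refine and_iff_right ?_
  unfold toggle
  split_ifs
  · exact DAgentEdge.xv e
  · exact DAgentEdge.xy e

theorem isImproving_activate (h : Good σ S f) (he : e ∈ S) :
    (dMDP n).IsImproving (policy σ S) (activate e) ↔ 0 < cost f e := by
  rw [MDP.IsImproving, h.reducedCost_activate he, mul_pos_iff_of_pos_left e.src.p_pos]
  exact and_iff_right (DAgentEdge.vx e)

theorem eq_of_isImproving (h : Good σ S f) (hq : (dMDP n).IsImproving (policy σ S) q) :
    (∃ e, q = toggle S e) ∨ ∃ e ∈ S, q = activate e := by
  obtain ⟨h1, h2⟩ := hq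
  rw [h.reducedCost_eq] at h2
  change DAgentEdge n q at h1
  rcases h1 with e | e | e | e | _
  · by_cases he : e ∈ S
    · exact .inr ⟨e, he, rfl⟩
    · simp [dReward, dValue, he] at h2
  · by_cases he : e ∈ S
    · exact .inl ⟨e, by simp [toggle, he]⟩
    · simp [dReward, dValue, he] at h2
  · by_cases he : e ∈ S
    · simp [dReward, dValue, he] at h2
    · exact .inl ⟨e, by simp [toggle, he]⟩
  · simp [dReward, dValue] at h2
  · simp [dReward, dValue] at h2

/-- Good policies are preserved by arbitrary improving switches. -/
theorem exists_of_isImproving (h : Good σ S f) (hq : (dMDP n).IsImproving (policy σ S) q) :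
    ∃ σ' S' f', Good σ' S' f' ∧ MDP.applySwitch (policy σ S) q = policy σ' S' := by
  rcases h.eq_of_isImproving hq with ⟨e, rfl⟩ | ⟨e, he, rfl⟩
  · exact ⟨_, _, _, h.toggled (h.isImproving_toggle.1 hq), applySwitch_toggle⟩
  · obtain ⟨f', hf', -⟩ := h.switch he ((h.isImproving_activate he).1 hq)
    exact ⟨_, _, _, hf', applySwitch_activate⟩

theorem sum_value (h : Good σ S f) :
    ∑ v : DAgent n, (dMDP n).value (policy σ S) (.inl v) = total S f := by
  rw [h.value_eq, total]

end Good

/-! ### The choices of the three rules -/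

namespace Good

/-- The two rules other than Bland's compare switches that toggle edges by the same quantity. -/
theorem chooses_toggle (h : Good σ S f)
    (hc : (dMDP n).Chooses N r (policy σ S) (toggle S e))
    (h' : 0 < if e' ∈ S then -cost f e' else cost f e') :
    N (toggle S e) ≤ N (toggle S e') ∨
      (e'.src.p * if e' ∈ S then -cost f e' else cost f e') ≤
        e.src.p * if e ∈ S then -cost f e else cost f e := by
  have hi := h.isImproving_toggle.2 h'
  have h1 := h.isImproving_toggle.1 hc.isImproving
  cases r with
  | bland => exact .inl (hc.2 _ hi)
  | dantzig =>
    have := hc.2 _ hi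
    rw [h.reducedCost_toggle, h.reducedCost_toggle] at this
    exact .inr this
  | largestIncrease =>
    have := hc.2 _ hi
    rw [applySwitch_toggle, applySwitch_toggle, (h.toggled h1).sum_value, (h.toggled h').sum_value,
      total_toggle, total_toggle] at this
    exact .inr (by linarith)

/-- If a prepared edge can be activated, then Largest Increase does not toggle any edge. -/
theorem chooses_toggle_of_activate (h : Good σ S f)
    (hc : (dMDP n).Chooses N r (policy σ S) (toggle S e)) (he' : e' ∈ S)
    (h' : 0 < cost f e') :
    N (toggle S e) ≤ N (activate e') ∨
      e'.src.p * cost f e' ≤ e.src.p * if e ∈ S then -cost f e else cost f e := by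
  have hi := (h.isImproving_activate he').2 h'
  have h1 := h.isImproving_toggle.1 hc.isImproving
  cases r with
  | bland => exact .inl (hc.2 _ hi)
  | dantzig =>
    have := hc.2 _ hi
    rw [h.reducedCost_toggle, h.reducedCost_activate he'] at this
    exact .inr this
  | largestIncrease =>
    exfalso
    obtain ⟨f', hf', h2, h3⟩ := h.switch he' h'
    have h4 := total_le (S := S) h2 h3
    have h5 := hc.2 _ hi
    rw [applySwitch_toggle, applySwitch_activate, (h.toggled h1).sum_value, hf'.sum_value,
      total_toggle] at h5
    have h6 := h.abs_cost_mul_lt e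
    have h7 := h.quarter_le_abs_cost h'.ne'
    rw [abs_of_pos h'] at h7
    have h8 : (e.src.p * if e ∈ S then -cost f e else cost f e) ≤ e.src.p * |cost f e| := by
      refine mul_le_mul_of_nonneg_left ?_ e.src.p_pos.le
      split_ifs
      · exact neg_le_abs _
      · exact le_abs_self _
    linarith

end Good

/-- As long as no prepared edge is improving, all rules either reset a prepared edge or prepare the
preferred edge, and the latter happens only if no prepared edge that starts in an earlier vertex has
negative reduced costs. -/
theorem Preferred.eq_of_chooses (hp : Preferred f e) (hN : IsBlandNumbering n N) (h : Good σ S f)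
    (he : e ∉ S) (hst : ∀ g ∈ S, cost f g ≤ 0) (hc : (dMDP n).Chooses N r (policy σ S) q) :
    ∃ g, q = toggle S g ∧ ((g ∈ S ∧ cost f g < 0) ∨
      (g = e ∧ ∀ g' ∈ S, g'.src.number < e.src.number → 0 ≤ cost f g')) := by
  rcases h.eq_of_isImproving hc.isImproving with ⟨g, rfl⟩ | ⟨g, hg, rfl⟩
  swap
  · exact absurd ((h.isImproving_activate hg).1 hc.isImproving) (hst g hg).not_gt
  refine ⟨g, rfl, ?_⟩
  have hi := h.isImproving_toggle.1 hc.isImproving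
  by_cases hg : g ∈ S
  · rw [if_pos hg] at hi
    exact .inl ⟨hg, by linarith⟩
  rw [if_neg hg] at hi
  obtain rfl : g = e := by
    by_contra hne
    have h1 := hp.number_lt hne hi
    have h2 := hp.mul_lt h hne hi
    have h3 := h.chooses_toggle hc (e' := e) (by rw [if_neg he]; exact hp.pos)
    simp only [if_neg he, if_neg hg, toggle] at h3
    have h4 := hN.xy_lt_vx e
    have h5 := hN.vx_lt_xy e g h1
    rcases h3 with h3 | h3
    · omega
    · linarith
  refine .inr ⟨rfl, fun g' hg' hlt => ?_⟩
  by_contra! hneg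
  have h3 := h.chooses_toggle hc (e' := g') (by rw [if_pos hg']; linarith)
  simp only [if_neg he, if_pos hg', toggle] at h3
  rcases h3 with h3 | h3
  · have := hN.xv_first g' g
    omega
  · have h4 := h.abs_cost_mul_lt_mul hlt hneg.ne
    rw [abs_of_neg hneg, abs_of_pos hi] at h4
    linarith

/-- After the preferred edge has been prepared, all rules either reset a prepared edge or activate
the preferred edge. -/
theorem Preferred.eq_of_chooses_of_mem (hp : Preferred f e) (hN : IsBlandNumbering n N)
    (h : Good σ S f) (he : e ∈ S) (hst : ∀ g ∈ S, g ≠ e → cost f g ≤ 0)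
    (hc : (dMDP n).Chooses N r (policy σ S) q) :
    q = activate e ∨ ∃ g ∈ S, cost f g < 0 ∧ q = toggle S g := by
  rcases h.eq_of_isImproving hc.isImproving with ⟨g, rfl⟩ | ⟨g, hg, rfl⟩
  · right
    have hi := h.isImproving_toggle.1 hc.isImproving
    by_cases hg : g ∈ S
    · rw [if_pos hg] at hi
      exact ⟨g, hg, by linarith, rfl⟩
    exfalso
    rw [if_neg hg] at hi
    have hne : g ≠ e := by rintro rfl; exact hg he
    have h1 := hp.number_lt hne hi
    have h2 := hp.mul_lt h hne hi
    have h3 := h.chooses_toggle_of_activate hc he hp.pos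
    simp only [if_neg hg, toggle, activate] at h3
    have h5 := hN.vx_lt_xy e g h1
    rcases h3 with h3 | h3
    · omega
    · linarith
  · left
    have hi := (h.isImproving_activate hg).1 hc.isImproving
    by_cases hge : g = e
    · rw [hge]
    · exact absurd hi (hst g hg hge).not_gt

/-! ### The switches that correspond to one switch in `B n` -/

theorem Preferred.minSwitches_of_mem (hp : Preferred f e) (hN : IsBlandNumbering n N)
    (hM : ∀ S' ⊆ S, ∀ f', Good (Function.update σ e.src e) S' f' →
      (dMDP n).MinSwitches N (policy (Function.update σ e.src e) S') M)
    (h : Good σ S f) (he : e ∈ S) (hst : ∀ g ∈ S, g ≠ e → cost f g ≤ 0) :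
    (dMDP n).MinSwitches N (policy σ S) (M + 1) := by
  induction S using Finset.strongInduction with
  | H S ih =>
  refine .step ⟨_, (h.isImproving_activate he).2 hp.pos⟩ fun r q hc => ?_
  rcases hp.eq_of_chooses_of_mem hN h he hst hc with rfl | ⟨g, hg, hneg, rfl⟩
  · obtain ⟨f', hf', -⟩ := h.switch he hp.pos
    rw [applySwitch_activate]
    exact hM S subset_rfl f' hf'
  · rw [applySwitch_toggle, if_pos hg]
    have hge : e ≠ g := by rintro rfl; exact absurd hp.pos hneg.not_gt
    refine (ih (S.erase g) (Finset.erase_ssubset hg)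
      (fun S' hS' => hM S' (hS'.trans (Finset.erase_subset _ _))) (h.erase hneg)
      (Finset.mem_erase.2 ⟨hge, he⟩) fun g' hg' => hst g' (Finset.mem_of_mem_erase hg')).mono
      (Nat.le_succ M)

/-- If no prepared edge is improving, then all rules reset some prepared edges, prepare the
preferred edge, reset some further edges, and then activate the preferred edge. Prepared edges in
earlier vertices that have negative reduced costs are reset before the preferred edge is prepared.
-/
theorem Preferred.minSwitches (hp : Preferred f e) (hN : IsBlandNumbering n N)
    (hM : ∀ S' f', Good (Function.update σ e.src e) S' f' →
      (∀ g ∈ S', g = e ∨ (g ∈ S ∧ (g.src.number < e.src.number → 0 ≤ cost f g))) →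
      (dMDP n).MinSwitches N (policy (Function.update σ e.src e) S') M)
    (h : Good σ S f) (hst : ∀ g ∈ S, cost f g ≤ 0) :
    (dMDP n).MinSwitches N (policy σ S) (M + 1) := by
  induction S using Finset.strongInduction with
  | H S ih =>
  have he : e ∉ S := fun he => absurd hp.pos (hst e he).not_gt
  refine .step ⟨_, (h.isImproving_toggle (e := e)).2 (by rw [if_neg he]; exact hp.pos)⟩
    fun r q hc => ?_
  obtain ⟨g, rfl, ⟨hg, hneg⟩ | ⟨rfl, hlow⟩⟩ := hp.eq_of_chooses hN h he hst hc
  · rw [applySwitch_toggle, if_pos hg]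
    refine (ih (S.erase g) (Finset.erase_ssubset hg) (fun S' f' hf' hS' => hM S' f' hf' ?_)
      (h.erase hneg) fun g' hg' => hst g' (Finset.mem_of_mem_erase hg')).mono (Nat.le_succ M)
    exact fun g' hg' => (hS' g' hg').imp_right fun h' => ⟨Finset.mem_of_mem_erase h'.1, h'.2⟩
  · rw [applySwitch_toggle, if_neg he]
    refine (hp.minSwitches_of_mem hN (fun S' hS' f' hf' => hM S' f' hf' fun g' hg' => ?_)
      (h.insert g) (Finset.mem_insert_self _ _) fun g' hg' hne => ?_).mono (Nat.le_succ M)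
    · rcases Finset.mem_insert.1 (hS' hg') with rfl | hg'
      · exact .inl rfl
      · exact .inr ⟨hg', hlow g' hg'⟩
    · exact hst g' (Finset.mem_of_mem_insert_of_ne hg' hne)

end Rules

section Simulation

variable {n : ℕ} {σ : BVertex n → BEdge n} {S S' : Finset (BEdge n)} {f f' : BVertex n → ℝ}
  {c : Config} {e e' : Edge} {T : ℝ} {M : ℕ}

/-! ### Configurations as policies -/

/-- The edge of `B n` that is given by an edge of a valid level. -/
def ofEdge : (e : Edge) → e.level < n → BEdge n
  | .travel i, h => .travel ⟨i, h⟩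
  | .enter i, h => .enter ⟨i, h⟩
  | .skip i, h => .skip ⟨i, h⟩
  | .board i, h => .board ⟨i, h⟩
  | .stay i, h => .stay ⟨i, h⟩
  | .leave i, h => .leave ⟨i, h⟩

theorem eq_dummy_or_ofEdge (g : BEdge n) : g = .dummy ∨ ∃ e h, g = ofEdge e h := by
  cases g with
  | travel i => exact .inr ⟨.travel i, i.2, rfl⟩
  | enter i => exact .inr ⟨.enter i, i.2, rfl⟩
  | skip i => exact .inr ⟨.skip i, i.2, rfl⟩
  | board i => exact .inr ⟨.board i, i.2, rfl⟩
  | stay i => exact .inr ⟨.stay i, i.2, rfl⟩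
  | leave i => exact .inr ⟨.leave i, i.2, rfl⟩
  | dummy => exact .inl rfl

theorem number_src_ofEdge (h : e.level < n) : (ofEdge e h).src.number = e.rank + 1 := by
  cases e <;> simp only [ofEdge, BEdge.src, BVertex.number, Edge.rank] <;> omega

theorem ofEdge_injective (h : e.level < n) (h' : e'.level < n) (heq : ofEdge e h = ofEdge e' h') :
    e = e' := by
  cases e <;> cases e' <;> cases heq <;> rfl

theorem number_lt_of_prio (h : e.level < n) (h' : e'.level < n) (hr : e'.rank = e.rank)
    (hp : e.prio < e'.prio) : (ofEdge e h).number < (ofEdge e' h').number := by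
  cases e <;> cases e' <;> simp only [Edge.rank, Edge.prio] at hr hp <;>
    simp only [ofEdge, BEdge.number] <;> omega

/-- The policy of `B n` that is given by a configuration. If `t` does not travel to a valid level,
then it gets an edge with a different start vertex. -/
def ofConfig (c : Config) : BVertex n → BEdge n
  | .t => if h : c.travel < n then .travel ⟨c.travel, h⟩ else .dummy
  | .a i => match c.a i with
    | .enter => .enter i
    | .skip => .skip i
    | .board => .board i
  | .b i => if c.stays i then .stay i else .leave i
  | .d => .dummy
  | .s => .dummy

theorem ofConfig_switch (h : e.level < n) :
    ofConfig (c.switch e) = Function.update (ofConfig c) (ofEdge e h).src (ofEdge e h) := by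
  funext v
  cases e <;> cases v <;> simp only [ofEdge, BEdge.src, Function.update_apply, reduceCtorEq,
    if_false, if_true, BVertex.a.injEq, BVertex.b.injEq, ofConfig, Config.switch, Fin.ext_iff]
  case travel.t i => exact dif_pos h
  case stay.b i j => by_cases hj : (j : ℕ) = i <;> [subst hj; skip] <;> simp_all
  case leave.b i j => by_cases hj : (j : ℕ) = i <;> [subst hj; skip] <;> simp_all
  all_goals first | rfl | (split_ifs <;> simp_all [Fin.ext_iff])

/-- The value function of a configuration, given the value of `t`. -/
noncomputable def values (c : Config) (T : ℝ) : BVertex n → ℝ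
  | .t => T
  | .a i => c.A n T i
  | .b i => c.B n T i
  | .d => 0
  | .s => 0

theorem values_nextA (i : Fin n) : values c T (BVertex.nextA i) = c.A n T (i + 1) := by
  unfold BVertex.nextA
  split_ifs with h
  · rfl
  · rw [show (i : ℕ) + 1 = n by omega, Config.A_last]; rfl

theorem values_nextB (i : Fin n) : values c T (BVertex.nextB i) = c.B n T (i + 1) := by
  unfold BVertex.nextB
  split_ifs with h
  · rfl
  · rw [show (i : ℕ) + 1 = n by omega, Config.B_last]; rfl

theorem cost_values (h : e.level < n) : cost (values c T) (ofEdge e h) = c.z n T e := by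
  cases e <;> simp only [cost, ofEdge, BEdge.reward, BEdge.tgt, BEdge.src, values_nextA,
    values_nextB] <;> simp only [values, Config.z] <;> norm_num
  ring

/-- The value of `t` that occurs in `Ready` is unique, as it is the value of the policy. -/
theorem Good.values_eq (h : Good (ofConfig c) S f) (ht : c.travel < n)
    (hT : T = c.A n T c.travel) : f = values c T := by
  have hval : ∀ v : BVertex n, v ≠ .s →
      values c T v = (ofConfig c v).reward + values c T (ofConfig c v).tgt := by
    rintro (_ | i | i | _ | _) hv
    · simpa [ofConfig, ht, BEdge.reward, BEdge.tgt, values] using hT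
    · cases ha : c.a i <;> simp only [ofConfig, ha, BEdge.reward, BEdge.tgt, values_nextA] <;>
        simp only [values]
      · exact Config.A_of_enter i.2 ha
      · rw [Config.A_of_skip i.2 ha, zero_add]
      · rw [Config.A_of_board i.2 ha]; norm_num; ring
    · cases hb : c.stays i <;>
        simp only [ofConfig, hb, if_true, Bool.false_eq_true, if_false, BEdge.reward, BEdge.tgt,
          values_nextA, values_nextB] <;> simp only [values]
      · rw [Config.B_of_leave i.2 hb, zero_add]
      · rw [Config.B_of_stay i.2 hb]; norm_num
    · simp [ofConfig, BEdge.reward, BEdge.tgt, values]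
    · exact absurd rfl hv
  funext v
  induction v using h.wf.induction with
  | _ v ih =>
  by_cases hv : v = .s
  · rw [hv, h.value_s]; rfl
  · rw [h.value v hv, hval v hv, ih _ ⟨hv, rfl⟩]

/-- The edges in a set of edges of `B n`, except for `dummy`. -/
def edges (S : Finset (BEdge n)) : Set Edge := {e | ∃ h, ofEdge e h ∈ S}

theorem cost_dummy (c : Config) (T : ℝ) : cost (values c T) (.dummy : BEdge n) = 0 := by
  simp [cost, BEdge.reward, BEdge.tgt, BEdge.src, values]

theorem preferred_of_ready {s : Set Edge} (h : Ready n c T s e) :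
    Preferred (values c T) (ofEdge e h.valid) where
  pos := by rw [cost_values]; exact h.pos
  lower g hg := by
    rcases eq_dummy_or_ofEdge g with rfl | ⟨e', h', rfl⟩
    · exact (cost_dummy c T).le
    · rw [number_src_ofEdge, number_src_ofEdge] at hg
      rw [cost_values]
      exact h.lower e' h' (by omega)
  same g hg hne := by
    rcases eq_dummy_or_ofEdge g with rfl | ⟨e', h', rfl⟩
    · cases e <;> simp [BEdge.src, ofEdge] at hg
    · have hr : e'.rank = e.rank := by
        have := congrArg BVertex.number hg
        rw [number_src_ofEdge, number_src_ofEdge] at this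
        omega
      obtain ⟨h1, h2⟩ := h.same e' h' hr (by rintro rfl; exact hne rfl)
      rw [cost_values, cost_values]
      exact ⟨h1, fun hp => number_lt_of_prio _ _ hr (h2 hp)⟩

open Classical in
/-- The edges of `B n` that are prepared initially. -/
noncomputable def initialSet (n : ℕ) : Finset (BEdge n) :=
  Finset.univ.filter BEdge.ActiveInZero

theorem mem_initialSet {g : BEdge n} : g ∈ initialSet n ↔ g.ActiveInZero := by
  simp [initialSet]

theorem active_of_mem_edges_initialSet (he : e ∈ edges (initialSet n)) : Config.zero.Active e := by
  obtain ⟨h, he⟩ := he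
  rw [mem_initialSet] at he
  cases e <;> simp_all [ofEdge, BEdge.ActiveInZero, Config.Active, Config.zero]

theorem card_bVertex : Fintype.card (BVertex n) ≤ 2 * n + 4 := by
  have h : ∀ v : BVertex n, v.number < 2 * n + 4 := by
    intro v
    cases v <;> simp only [BVertex.number] <;> omega
  simpa using Fintype.card_le_of_injective (fun v => (⟨v.number, h v⟩ : Fin (2 * n + 4)))
    fun v w hvw => BVertex.number_injective (by simpa using hvw)

theorem card_bEdge : Fintype.card (BEdge n) ≤ 6 * n + 2 := by
  have h : ∀ e : BEdge n, e.number < 6 * n + 2 := by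
    intro e
    cases e <;> simp only [BEdge.number] <;> omega
  refine le_of_le_of_eq (Fintype.card_le_of_injective
    (fun e => (⟨e.number, h e⟩ : Fin (6 * n + 2))) fun e e' hee' => ?_) (Fintype.card_fin _)
  have hee' : e.number = e'.number := by simpa using hee'
  cases e <;> cases e' <;> simp only [BEdge.number] at hee' <;>
    first | rfl | omega | (congr 1; omega)

variable [NeZero n] {N : DAgent n × DVertex n → ℕ}

/-- Every switch in `B n` of a forced run is made by each of the three rules in `D n`. -/
theorem minSwitches_of_leads (hN : IsBlandNumbering n N) {s : Set Edge}
    {P : Config → Set Edge → Prop} (h : Leads n M c s P) (hS : edges S = s)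
    (hg : Good (ofConfig c) S f) : (dMDP n).MinSwitches N (policy (ofConfig c) S) M := by
  induction h generalizing S f with
  | done => exact fun _ _ _ _ => Nat.zero_le _
  | weaken hle _ ih => exact (ih hS hg).mono hle
  | @step M c s P T e hr _ ih =>
    subst hS
    obtain rfl := hg.values_eq hr.travel_lt hr.value_t
    refine (preferred_of_ready hr).minSwitches hN (fun S' f' hf' hS' => ?_) hg fun g hgS => ?_
    · rw [← ofConfig_switch] at hf' ⊢
      refine ih (edges S') (fun e' he' => ?_) rfl hf'
      obtain ⟨hl, he'⟩ := he'
      rcases hS' _ he' with heq | ⟨h1, h2⟩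
      · exact .inl (ofEdge_injective _ _ heq)
      · refine .inr ⟨⟨hl, h1⟩, fun _ hlt => le_antisymm (hr.lower e' hl hlt) ?_⟩
        rw [← cost_values hl]
        exact h2 (by rw [number_src_ofEdge, number_src_ofEdge]; omega)
    · rcases eq_dummy_or_ofEdge g with rfl | ⟨e', h', rfl⟩
      · exact (cost_dummy c T).le
      · rw [cost_values]
        exact hr.stale e' ⟨h', hgS⟩ h'

/-! ### The initial policy -/

theorem initialPolicy_eq : initialPolicy n = policy (ofConfig .zero) (initialSet n) := by
  funext u
  rcases u with (_ | i | i | _ | _) | g | g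
  · have : Config.zero.travel < n := NeZero.pos n
    simp only [policy, initialPolicy, ofConfig, dif_pos this, reduceCtorEq, if_false]
    rfl
  case x => by_cases hg : g.ActiveInZero <;> simp [policy, initialPolicy, mem_initialSet, hg]
  all_goals simp [policy, initialPolicy, ofConfig, Config.zero]

/-- All active edges of the initial policy have reward zero and lead to vertices with larger
numbers. -/
theorem good_initial : Good (ofConfig .zero) (initialSet n) (0 : BVertex n → ℝ) := by
  have h0 : ∀ v : BVertex n, v ≠ .s → (ofConfig .zero v).src = v ∧
      (ofConfig .zero v).ActiveInZero ∧ (ofConfig .zero v).reward = 0 ∧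
      v.number < (ofConfig .zero v).tgt.number := by
    have hA : ∀ i : Fin n, 2 * (i : ℕ) + 3 < (BVertex.nextA i).number := fun i => by
      unfold BVertex.nextA
      split_ifs <;> simp only [BVertex.number] <;> omega
    rintro (_ | i | i | _ | _) hv
    · have : Config.zero.travel < n := NeZero.pos n
      simp only [ofConfig, dif_pos this]
      simp [BEdge.src, BEdge.ActiveInZero, BEdge.reward, BEdge.tgt, BVertex.number, Config.zero]
    · have := hA i
      refine ⟨rfl, trivial, rfl, ?_⟩
      simp only [ofConfig, Config.zero, BEdge.tgt]
      rw [BVertex.number]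
      omega
    · have := hA i
      refine ⟨rfl, trivial, rfl, ?_⟩
      simp only [ofConfig, Config.zero, Bool.false_eq_true, if_false, BEdge.tgt]
      rw [BVertex.number]
      omega
    · simp [ofConfig, BEdge.src, BEdge.ActiveInZero, BEdge.reward, BEdge.tgt, BVertex.number]
    · exact absurd rfl hv
  have hwf : WellFounded fun w v : BVertex n => v.number < w.number :=
    haveI : IsTrans (BVertex n) fun w v => v.number < w.number := ⟨fun _ _ _ a b => lt_trans b a⟩
    haveI : Std.Irrefl fun w v : BVertex n => v.number < w.number := ⟨fun _ => lt_irrefl _⟩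
    Finite.wellFounded_of_trans_of_irrefl _
  refine ⟨fun v hv => (h0 v hv).1, fun v hv => mem_initialSet.2 (h0 v hv).2.1,
    Subrelation.wf ?_ hwf, rfl, fun v hv => ?_, fun v => le_rfl, fun v => ⟨0, by simp⟩⟩
  · rintro w v ⟨hv, rfl⟩
    exact (h0 v hv).2.2.2
  · simp [(h0 v hv).2.2.1]

theorem minSwitches_initialPolicy (hN : IsBlandNumbering n N) :
    (dMDP n).MinSwitches N (initialPolicy n) (2 ^ (n - 1)) := by
  rw [initialPolicy_eq]
  exact minSwitches_of_leads hN
    (leads_climb (fun e he _ => active_of_mem_edges_initialSet he) (n - 1)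
      (Nat.sub_add_cancel (NeZero.pos n)).le) rfl good_initial

theorem isWeakUnichain_of_isCombinedRun {X : ℕ → DAgent n → DVertex n}
    (hX : (dMDP n).IsCombinedRun N (initialPolicy n) X) (k : ℕ) :
    (dMDP n).IsWeakUnichain (X k) := by
  suffices h : ∃ σ S f, Good σ S f ∧ X k = policy σ S by
    obtain ⟨σ, S, f, hg, h⟩ := h
    rw [h]
    exact hg.isWeakUnichain
  induction k with
  | zero => exact ⟨_, _, _, good_initial, hX.1.trans initialPolicy_eq⟩
  | succ k ih =>
    obtain ⟨σ, S, f, hg, h⟩ := ih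
    rcases hX.2 k with ⟨r, q, hc, h1⟩ | ⟨-, h1⟩
    · rw [h] at hc h1
      rw [h1]
      exact hg.exists_of_isImproving hc.isImproving
    · exact ⟨σ, S, f, hg, h1.trans h⟩

theorem le_numSwitches (hN : IsBlandNumbering n N) {X : ℕ → DAgent n → DVertex n}
    (hX : (dMDP n).IsCombinedRun N (initialPolicy n) X) :
    ENNReal.ofReal (1 / 2 * 2 ^ n) ≤ ((dMDP n).numSwitches X : ℝ≥0∞) := by
  have h1 : (1 / 2 * 2 ^ n : ℝ) = (2 ^ (n - 1) : ℕ) := by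
    obtain ⟨m, rfl⟩ : ∃ m, n = m + 1 := ⟨n - 1, (Nat.sub_add_cancel (NeZero.pos n)).symm⟩
    simp only [Nat.add_sub_cancel]
    push_cast
    ring
  rw [h1, ENNReal.ofReal_natCast]
  have h2 := (minSwitches_initialPolicy hN).le_numSwitches hX
  exact_mod_cast ENat.toENNReal_le.2 h2

/-! ### The size of `D n` -/

theorem size_le : (dMDP n).size ≤ 79 * n := by
  have hV := card_bVertex (n := n)
  have hE := card_bEdge (n := n)
  have hA : Fintype.card (DAgent n) ≤ Fintype.card (BVertex n ⊕ BEdge n ⊕ BEdge n) :=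
    Fintype.card_le_of_surjective
      (Sum.elim DAgent.base (Sum.elim DAgent.x DAgent.z)) (by
        rintro (v | e | e)
        · exact ⟨.inl v, rfl⟩
        · exact ⟨.inr (.inl e), rfl⟩
        · exact ⟨.inr (.inr e), rfl⟩)
  have hAE : (dMDP n).agentEdge.ncard ≤ Fintype.card (Option (Fin 4 × BEdge n)) := by
    let F : Option (Fin 4 × BEdge n) → DAgent n × DVertex n
      | none => (.base .s, .inl (.base .s))
      | some (0, e) => (.base e.src, .inl (.x e))
      | some (1, e) => (.x e, .inl (.base e.src))
      | some (2, e) => (.x e, .inr e)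
      | some (3, e) => (.z e, .inl (.base e.tgt))
    have hF : (dMDP n).agentEdge ⊆ F '' Set.univ := by
      rintro _ (e | e | e | e | _)
      · exact ⟨some (0, e), trivial, rfl⟩
      · exact ⟨some (1, e), trivial, rfl⟩
      · exact ⟨some (2, e), trivial, rfl⟩
      · exact ⟨some (3, e), trivial, rfl⟩
      · exact ⟨none, trivial, rfl⟩
    rw [← Nat.card_eq_fintype_card, ← Set.ncard_univ]
    exact (Set.ncard_le_ncard hF).trans (Set.ncard_image_le)
  have hRE : (dMDP n).randEdge.ncard ≤ Fintype.card (BEdge n ⊕ BEdge n) := by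
    let F : BEdge n ⊕ BEdge n → BEdge n × DVertex n :=
      Sum.elim (fun e => (e, .inl (.base e.src))) fun e => (e, .inl (.z e))
    have hF : (dMDP n).randEdge ⊆ F '' Set.univ := by
      rintro _ (e | e)
      · exact ⟨.inl e, trivial, rfl⟩
      · exact ⟨.inr e, trivial, rfl⟩
    rw [← Nat.card_eq_fintype_card, ← Set.ncard_univ]
    exact (Set.ncard_le_ncard hF).trans (Set.ncard_image_le)
  -- The bounds add up to `56 * n + 23`.
  simp only [Fintype.card_sum, Fintype.card_option, Fintype.card_prod, Fintype.card_fin] at *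
  have := NeZero.pos n
  rw [MDP.size]
  omega

end Simulation

end TwinProcess

theorem corollary2 :
    (∃ C : ℕ, ∀ (n : ℕ) [NeZero n], (dMDP n).size ≤ C * n) ∧
    ∃ c : ℝ, 0 < c ∧ ∀ (n : ℕ) [NeZero n],
      (dMDP n).IsWeakUnichain (initialPolicy n) ∧
      ∀ N : DAgent n × DVertex n → ℕ, IsBlandNumbering n N →
        -- every choice of a rule in every step
        (∀ X : ℕ → DAgent n → DVertex n,
          (dMDP n).IsCombinedRun N (initialPolicy n) X →
            (∀ k, (dMDP n).IsWeakUnichain (X k)) ∧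
            ENNReal.ofReal (c * 2 ^ n) ≤ ((dMDP n).numSwitches X : ℝ≥0∞)) ∧
        -- random choices: almost surely and in expectation
        (∀ (Ω : Type*) [MeasurableSpace Ω] (μ : MeasureTheory.Measure Ω)
          [MeasureTheory.IsProbabilityMeasure μ] (X : ℕ → Ω → DAgent n → DVertex n),
          (∀ᵐ ω ∂μ, (dMDP n).IsCombinedRun N (initialPolicy n) (fun k => X k ω)) →
            (∀ᵐ ω ∂μ, ENNReal.ofReal (c * 2 ^ n) ≤
              ((dMDP n).numSwitches (fun k => X k ω) : ℝ≥0∞)) ∧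
            ENNReal.ofReal (c * 2 ^ n) ≤
              ∫⁻ ω, ((dMDP n).numSwitches (fun k => X k ω) : ℝ≥0∞) ∂μ) := by
  refine ⟨⟨79, fun n _ => TwinProcess.size_le⟩, 1 / 2, by norm_num, fun n _ => ⟨?_, fun N hN =>
    ⟨fun X hX => ⟨TwinProcess.isWeakUnichain_of_isCombinedRun hX, TwinProcess.le_numSwitches hN hX⟩,
      fun Ω _ μ _ X hX => ?_⟩⟩⟩
  · rw [TwinProcess.initialPolicy_eq]
    exact TwinProcess.good_initial.isWeakUnichain
  · have h := hX.mono fun ω hω => TwinProcess.le_numSwitches hN hω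
    exact ⟨h, by simpa using MeasureTheory.lintegral_mono_ae h⟩
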